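/- Let $\varepsilon_{it}$ ($i\in\mathbb N$, $t\in\mathbb Z$) be independent real random variables with $\mathbb E[\varepsilon_{it}]=0$, $\mathbb E[\varepsilon_{it}^2]=1$ and $\sup_{i,t}\mathbb E[\varepsilon_{it}^4]<\infty$. For every $n$ let $\Psi_k=\Psi_k^{(n)}$ ($k\ge 0$) be diagonal real $n\times n$ matrices, and suppose that there are constants $b,B>0$, independent of $n$, such that $$\min_{1\le j\le n}\Big|\sum_{k=0}^\infty(\Psi_k)_{jj}\Big|\ge b,\qquad \max_{1\le j\le n}\sum_{k=0}^\infty(1+k)|(\Psi_k)_{jj}|\le B .$$ Let $T=T(n)\to\infty$ as $n\to\infty$ with $n/T\to c\in(0,\infty)$. Put $e_t:=\sum_{k=0}^\infty\Psi_k\varepsilon_{t-k}\in\mathbb R^n$, where $\varepsilon_t=(\varepsilon_{1t},\dots,\varepsilon_{nt})'$, and let $\boldsymbol e_j$ be the $j$-th row of the $n\times T$ matrix $[e_1,\dots,e_T]$. For $1\le k\le T-1$ let $$\sigma_k:=\frac1{2\sin(\pi k/(2T))},\qquad \boldsymbol v_k:=\Big(\sqrt{2/T}\,\sin\big(\pi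 k(t-1)/T\big)\Big)_{t=1}^{T}\in\mathbb R^T,$$ and for $1\le j\le n$ and $1\le k,l\le T-1$ let $$M_{j,kl}:=\frac{\sigma_k\sigma_l(\boldsymbol e_j\boldsymbol v_k)(\boldsymbol e_j\boldsymbol v_l)}{\sum_{t=1}^{T-1}\sigma_t^2(\boldsymbol e_j\boldsymbol v_t)^2}$$ (read as $0$ where the denominator vanishes). Let $Z_1,Z_2,\dots$ be i.i.d. standard normal random variables and $\mathcal M_{k,l}:=(kl)^{-1}Z_kZ_l\big/\sum_{t=1}^\infty t^{-2}Z_t^2$. Then for every fixed positive integer $K$ the array $$\Big\{\frac1{\sqrt n}\sum_{j=1}^n\big(M_{j,kl}-\mathbb E[M_{j,kl}]\big):\ k,l=1,\dots,K\Big\}$$ (defined for all $n$ with $T(n)>K$) converges jointly in distribution, as $n\to\infty$, to a (possibly degenerate) centred $K\times K$-dimensional Gaussian array $(G_{k,l})$ with $\operatorname{Cov}(G_{k,l},G_{p,q})=\operatorname{Cov}(\mathcal M_{k,l},\mathcal M_{p,q})$. -/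

import Mathlib

open MeasureTheory ProbabilityTheory Filter Topology
open scoped Matrix

noncomputable section

namespace UnitRootCLT

/-- The noise assumption: the variables `ε i t` (`i ∈ ℕ`, `t ∈ ℤ`) are independent, centred, of unit
variance, with uniformly bounded fourth moments. Their distributions may differ. -/
structure NoiseAssumption {Ω : Type*} [MeasurableSpace Ω] (P : Measure Ω)
    (ε : ℕ → ℤ → Ω → ℝ) : Prop where
  measurable : ∀ i t, Measurable (ε i t)
  indep : iIndepFun (fun p : ℕ × ℤ => ε p.1 p.2) P
  mean_zero : ∀ i t, Integrable (ε i t) P ∧ ∫ ω, ε i t ω ∂P = 0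
  var_one : ∀ i t, ∫ ω, ε i t ω ^ 2 ∂P = 1
  fourth_moment : ∃ κ : ℝ, ∀ i t,
    Integrable (fun ω => ε i t ω ^ 4) P ∧ ∫ ω, ε i t ω ^ 4 ∂P ≤ κ

/-- The assumption on the matrix lag polynomials `Ψ(L) = ∑ₖ Ψₖ Lᵏ`, one for each dimension `n`: the
coefficients are diagonal, and the bounds `b`, `B` are common to all dimensions and coordinates. -/
structure LagAssumption (Ψ : (n : ℕ) → ℕ → Matrix (Fin n) (Fin n) ℝ) : Prop where
  diagonal : ∀ n k, (Ψ n k).IsDiag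
  bounds : ∃ b B : ℝ, 0 < b ∧ 0 < B ∧ ∀ (n : ℕ) (j : Fin n),
    Summable (fun k : ℕ => (1 + (k : ℝ)) * |Ψ n k j j|) ∧
    ∑' k : ℕ, (1 + (k : ℝ)) * |Ψ n k j j| ≤ B ∧
    b ≤ |∑' k : ℕ, Ψ n k j j|

/-- The linear process `e_t = Ψ(L) ε_t = ∑ₖ Ψₖ ε_{t-k}` in dimension `n`. -/
def linearProcess {Ω : Type*} (ε : ℕ → ℤ → Ω → ℝ) {n : ℕ} (Ψ : ℕ → Matrix (Fin n) (Fin n) ℝ)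
    (t : ℤ) (ω : Ω) : Fin n → ℝ :=
  ∑' k : ℕ, Ψ k *ᵥ (fun i : Fin n => ε (i : ℕ) (t - (k : ℤ)) ω)

/-- `σ_k = 1 / (2 sin (π k / (2T)))` for `1 ≤ k ≤ T - 1` (and `σ_k = 0` for `k ≥ T`). -/
def sigma (T k : ℕ) : ℝ :=
  if k < T then (2 * Real.sin (Real.pi * k / (2 * T)))⁻¹ else 0

/-- The `t`-th coordinate `√(2/T) sin (π k (t - 1) / T)` of the vector `v_k`, for `1 ≤ t ≤ T`. -/
def vCoord (T k t : ℕ) : ℝ :=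
  Real.sqrt (2 / T) * Real.sin (Real.pi * k * ((t : ℝ) - 1) / T)

/-- `e_j v_k`, where `e_j` is the `j`-th row of the noise matrix `[e_1, …, e_T]`. -/
def rowDot {Ω : Type*} (ε : ℕ → ℤ → Ω → ℝ) {n : ℕ} (Ψ : ℕ → Matrix (Fin n) (Fin n) ℝ)
    (T : ℕ) (j : Fin n) (k : ℕ) (ω : Ω) : ℝ :=
  ∑ t ∈ Finset.Icc 1 T, linearProcess ε Ψ (t : ℤ) ω j * vCoord T k t

/-- `M_{j,kl} = σ_k σ_l (e_j v_k) (e_j v_l) / ∑_{t=1}^{T-1} σ_t² (e_j v_t)²`. -/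
def M {Ω : Type*} (ε : ℕ → ℤ → Ω → ℝ) {n : ℕ} (Ψ : ℕ → Matrix (Fin n) (Fin n) ℝ)
    (T : ℕ) (j : Fin n) (k l : ℕ) (ω : Ω) : ℝ :=
  sigma T k * sigma T l * rowDot ε Ψ T j k ω * rowDot ε Ψ T j l ω /
    ∑ t ∈ Finset.Ico 1 T, sigma T t ^ 2 * rowDot ε Ψ T j t ω ^ 2

/-- The normalized centred array `n^{-1/2} ∑_j (M_{j,kl} - E M_{j,kl})`, `1 ≤ k, l ≤ K`; the entry
`(a, b) : Fin K × Fin K` is the one with `k = a + 1` and `l = b + 1`. -/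
def normalizedArray {Ω : Type*} [MeasurableSpace Ω] (P : Measure Ω) (ε : ℕ → ℤ → Ω → ℝ) {n : ℕ}
    (Ψ : ℕ → Matrix (Fin n) (Fin n) ℝ) (T K : ℕ) (ω : Ω) : EuclideanSpace ℝ (Fin K × Fin K) :=
  WithLp.toLp 2 fun p : Fin K × Fin K =>
    (Real.sqrt n)⁻¹ * ∑ j : Fin n,
      (M ε Ψ T j ((p.1 : ℕ) + 1) ((p.2 : ℕ) + 1) ω - ∫ ω', M ε Ψ T j ((p.1 : ℕ) + 1) ((p.2 : ℕ) + 1) ω' ∂P)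

/-- `𝓜_{k,l} = (k l)⁻¹ Z_k Z_l / ∑_{t ≥ 1} t⁻² Z_t²`. -/
def limitM {Ω' : Type*} (Z : ℕ+ → Ω' → ℝ) (k l : ℕ+) (ω : Ω') : ℝ :=
  ((k : ℝ) * (l : ℝ))⁻¹ * Z k ω * Z l ω / ∑' t : ℕ+, ((t : ℝ) ^ 2)⁻¹ * Z t ω ^ 2

/-- The covariance matrix of the array `(𝓜_{k,l})`, `1 ≤ k, l ≤ K`. -/
def limitCov {Ω' : Type*} [MeasurableSpace Ω'] (P' : Measure Ω') (Z : ℕ+ → Ω' → ℝ) (K : ℕ) :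
    Matrix (Fin K × Fin K) (Fin K × Fin K) ℝ :=
  Matrix.of fun p q =>
    cov[limitM Z (p.1 : ℕ).succPNat (p.2 : ℕ).succPNat,
      limitM Z (q.1 : ℕ).succPNat (q.2 : ℕ).succPNat; P']

end UnitRootCLT

end

/-! Since the `Ψ n k` are diagonal, row `j` is a function of the noise path `ε j` alone, so the rows
are independent; and once `K < T` the entries `M` are bounded by 1, because a product of two terms
is dominated by the sum of squares in the denominator. By Cramér–Wold it suffices to treat a fixed
linear combination `∑ s_{kl} M_{j,kl}`. For bounded independent summands the Lyapunov error is of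
order `n^{-1/2}`, so the only thing left to prove is that the average of the row variances converges
to the variance of `∑ s_{kl} 𝓜_{k,l}`. That follows if the first two moments of the row variables
converge uniformly in `j`.

Uniformity is obtained by working along the filter `comap Sigma.fst atTop` on the pairs `(n, j)`: a
limit along it is a limit as `n → ∞` uniform in the row.

For one row, `M` is unchanged when all products `σ_k (e_j v_k)` are multiplied by `π / (T ∑ᵢ ψᵢ)`.
Summation by parts replaces `e_j v_k` by `(∑ᵢ ψᵢ) ∑ₜ ε_{jt} v_k(t)`, with an `L¹` error controlled
by `∑ i |ψᵢ|` times the variation of `v_k`, which is `O(T^{-1/2})`. The `v_k` are orthonormal with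
entries at most `√(2/T)`, so the Lyapunov bound makes the normalized products asymptotically
independent standard normal, and `π σ_k / T → 1/k` (`tendsto_integral_exp_rowCoord`).

To pass to the ratio, the denominator is cut after `m` terms and increased by `δ`
(`tendsto_integral_quadRatio`). The cut is harmless because the `k`-th term has mean `O(k⁻²)`
uniformly in the row, and the `δ` because the limit denominator is at least `Z_1² > 0` almost
surely. -/

namespace UnitRootCLT

/-! ### Lyapunov bound for characteristic functions -/

section Lyapunov

theorem norm_exp_mul_I_sub_taylor_two_le (x : ℝ) :
    ‖Complex.exp (x * Complex.I) - (1 + x * Complex.I - x ^ 2 / 2)‖ ≤ 4 * |x| ^ 3 := by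
  have hn : ‖(x : ℂ) * Complex.I‖ = |x| := by simp
  rcases le_or_gt |x| 1 with hx | hx
  · have h := Complex.exp_bound (x := x * Complex.I) (by rw [hn]; exact hx) (n := 3) (by norm_num)
    rw [hn] at h
    simp only [Finset.sum_range_succ, Finset.sum_range_zero] at h
    have e : (1 + x * Complex.I - x ^ 2 / 2 : ℂ) = 0 + (x * Complex.I) ^ 0 / (Nat.factorial 0 : ℂ)
        + (x * Complex.I) ^ 1 / (Nat.factorial 1 : ℂ)
        + (x * Complex.I) ^ 2 / (Nat.factorial 2 : ℂ) := by
      simp [mul_pow, Nat.factorial]; ring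
    rw [e]
    refine h.trans ?_
    rw [mul_comm]
    gcongr
    norm_num [Nat.factorial]
  · have h1 : ‖Complex.exp (x * Complex.I)‖ = 1 := Complex.norm_exp_ofReal_mul_I x
    have h2 : ‖(1 + x * Complex.I - x ^ 2 / 2 : ℂ)‖ ≤ 1 + |x| + |x| ^ 2 / 2 := by
      refine (norm_sub_le _ _).trans (add_le_add ((norm_add_le _ _).trans ?_) ?_)
      · simp
      · simp
    refine (norm_sub_le _ _).trans ?_
    rw [h1]
    nlinarith [mul_pos (sub_pos.2 hx) (sub_pos.2 hx), pow_pos (sub_pos.2 hx) 3]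

theorem abs_exp_neg_sub_le {s : ℝ} (hs : 0 ≤ s) : |Real.exp (-s) - (1 - s)| ≤ s ^ 2 := by
  rcases le_or_gt s 1 with h | h
  · have := Real.abs_exp_sub_one_sub_id_le (x := -s) (by rw [abs_neg, abs_of_nonneg hs]; exact h)
    rw [show Real.exp (-s) - (1 - s) = Real.exp (-s) - 1 - -s by ring, ← neg_sq]
    exact this
  · have h1 := Real.add_one_le_exp (-s)
    have h2 : Real.exp (-s) ≤ 1 := Real.exp_le_one_iff.2 (by linarith)
    rw [abs_of_nonneg (by linarith)]
    nlinarith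

/-- Factors are exchanged one at a time; the untouched ones have norm at most 1. -/
theorem norm_prod_sub_prod_le {τ : Type*} (s : Finset τ) (z w : τ → ℂ)
    (hz : ∀ i ∈ s, ‖z i‖ ≤ 1) (hw : ∀ i ∈ s, ‖w i‖ ≤ 1) :
    ‖∏ i ∈ s, z i - ∏ i ∈ s, w i‖ ≤ ∑ i ∈ s, ‖z i - w i‖ := by
  classical
  induction s using Finset.induction_on with
  | empty => simp
  | insert a s ha ih =>
    rw [Finset.prod_insert ha, Finset.prod_insert ha, Finset.sum_insert ha]
    have ih' := ih (fun i hi => hz i (Finset.mem_insert_of_mem hi))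
      (fun i hi => hw i (Finset.mem_insert_of_mem hi))
    have e : z a * ∏ i ∈ s, z i - w a * ∏ i ∈ s, w i
        = (z a - w a) * ∏ i ∈ s, z i + w a * (∏ i ∈ s, z i - ∏ i ∈ s, w i) := by ring
    rw [e]
    refine (norm_add_le _ _).trans (add_le_add ?_ ?_)
    · rw [norm_mul]
      refine mul_le_of_le_one_right (norm_nonneg _) ?_
      rw [norm_prod]
      exact Finset.prod_le_one (fun _ _ => norm_nonneg _)
        (fun i hi => hz i (Finset.mem_insert_of_mem hi))
    · rw [norm_mul]
      exact (mul_le_of_le_one_left (norm_nonneg _) (hw a (Finset.mem_insert_self _ _))).trans ih'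

variable {Ω : Type*} [MeasurableSpace Ω] {P : Measure Ω} [IsProbabilityMeasure P]

/-- Both terms are compared with `1 - v / 2`, where `v = E X²`: the first by Taylor expansion, at
the cost of the third moment, the second with error at most `v²`, which is bounded by the fourth
moment because the variance of `X²` is nonnegative. -/
theorem norm_integral_exp_mul_I_sub_le {X : Ω → ℝ} (hX : MemLp X 4 P) (h0 : ∫ ω, X ω ∂P = 0) :
    ‖∫ ω, Complex.exp (X ω * Complex.I) ∂P - Complex.exp (-((∫ ω, X ω ^ 2 ∂P : ℝ) / 2 : ℂ))‖
      ≤ 4 * ∫ ω, |X ω| ^ 3 ∂P + ∫ ω, X ω ^ 4 ∂P := by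
  have i1 : Integrable X P := hX.integrable (by norm_num)
  have i2 : Integrable (fun ω => X ω ^ 2) P := by
    simpa using (hX.mono_exponent (p := 2) (by norm_num)).integrable_norm_pow (by norm_num)
  have i3 : Integrable (fun ω => |X ω| ^ 3) P := by
    simpa using (hX.mono_exponent (p := 3) (by norm_num)).integrable_norm_pow (by norm_num)
  have i4 : Integrable (fun ω => X ω ^ 4) P := by
    have := hX.integrable_norm_pow (by norm_num)
    simpa [Even.pow_abs (show Even 4 by decide)] using this
  have hE : Integrable (fun ω => Complex.exp (X ω * Complex.I)) P := by
    refine Integrable.of_bound (C := 1) ?_ (ae_of_all _ fun ω => ?_)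
    · exact (Complex.continuous_exp.comp
        (Complex.continuous_ofReal.mul continuous_const)).comp_aestronglyMeasurable
        hX.aestronglyMeasurable
    · rw [Complex.norm_exp_ofReal_mul_I]
  set v := ∫ ω, X ω ^ 2 ∂P with hv
  have hv0 : 0 ≤ v := integral_nonneg fun ω => by positivity
  have hT : ∫ ω, (1 + X ω * Complex.I - X ω ^ 2 / 2 : ℂ) ∂P = 1 - v / 2 := by
    have j1 : Integrable (fun ω => (X ω : ℂ) * Complex.I) P := i1.ofReal.mul_const _
    have j2 : Integrable (fun ω => (X ω : ℂ) ^ 2 / 2) P := by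
      simpa using (i2.ofReal (𝕜 := ℂ)).div_const 2
    have j0 : Integrable (fun ω => (1 : ℂ) + X ω * Complex.I) P := (integrable_const _).add j1
    rw [integral_sub j0 j2, integral_add (integrable_const _) j1,
      integral_mul_const, integral_complex_ofReal, h0, integral_div]
    have : ∫ ω, (X ω : ℂ) ^ 2 ∂P = v := by
      rw [hv, ← integral_complex_ofReal]; simp
    simp [this]
  have hTi : Integrable (fun ω => (1 + X ω * Complex.I - X ω ^ 2 / 2 : ℂ)) P := by
    refine ((integrable_const _).add (i1.ofReal.mul_const _)).sub ?_
    simpa using (i2.ofReal (𝕜 := ℂ)).div_const 2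
  have hA : ‖∫ ω, Complex.exp (X ω * Complex.I) ∂P - (1 - v / 2)‖ ≤ 4 * ∫ ω, |X ω| ^ 3 ∂P := by
    rw [← hT, ← integral_sub hE hTi, ← integral_const_mul]
    exact norm_integral_le_of_norm_le (i3.const_mul 4)
      (ae_of_all _ fun ω => norm_exp_mul_I_sub_taylor_two_le (X ω))
  have hJ : v ^ 2 ≤ ∫ ω, X ω ^ 4 ∂P := by
    have m2 : MemLp (fun ω => X ω ^ 2) 2 P := by
      rw [memLp_two_iff_integrable_sq i2.aestronglyMeasurable]
      simpa [← pow_mul] using i4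
    have := variance_nonneg (fun ω => X ω ^ 2) P
    rw [variance_eq_sub m2] at this
    simpa [← pow_mul, ← hv] using this
  have hB : ‖(1 - v / 2 : ℂ) - Complex.exp (-(v / 2 : ℂ))‖ ≤ ∫ ω, X ω ^ 4 ∂P := by
    have h := abs_exp_neg_sub_le (s := v / 2) (by positivity)
    have e : (1 - v / 2 : ℂ) - Complex.exp (-(v / 2 : ℂ))
        = -((Real.exp (-(v / 2)) - (1 - v / 2) : ℝ) : ℂ) := by
      push_cast; ring
    rw [e, norm_neg, Complex.norm_real, Real.norm_eq_abs]
    refine h.trans (le_trans ?_ hJ)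
    nlinarith [sq_nonneg v]
  calc _ ≤ _ := norm_sub_le_norm_sub_add_norm_sub _ (1 - v / 2 : ℂ) _
    _ ≤ _ := add_le_add hA hB

/-- A quantitative Lyapunov central limit theorem for characteristic functions. -/
theorem norm_integral_exp_sum_sub_le {τ : Type*} (s : Finset τ) {X : τ → Ω → ℝ}
    (hi : iIndepFun X P) (hX : ∀ t ∈ s, MemLp (X t) 4 P) (h0 : ∀ t ∈ s, ∫ ω, X t ω ∂P = 0) :
    ‖∫ ω, Complex.exp ((∑ t ∈ s, X t ω : ℝ) * Complex.I) ∂P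
        - Complex.exp (-((∑ t ∈ s, ∫ ω, X t ω ^ 2 ∂P : ℝ) / 2 : ℂ))‖
      ≤ ∑ t ∈ s, (4 * ∫ ω, |X t ω| ^ 3 ∂P + ∫ ω, X t ω ^ 4 ∂P) := by
  have hm : ∀ t ∈ s, AEMeasurable (X t) P := fun t ht => (hX t ht).aestronglyMeasurable.aemeasurable
  have key : ∀ Y : Ω → ℝ, AEMeasurable Y P →
      charFun (P.map Y) 1 = ∫ ω, Complex.exp (Y ω * Complex.I) ∂P := by
    intro Y hY
    rw [charFun_apply_real, integral_map hY (by fun_prop)]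
    simp
  have h1 : ∫ ω, Complex.exp ((∑ t ∈ s, X t ω : ℝ) * Complex.I) ∂P
      = ∏ t ∈ s, ∫ ω, Complex.exp (X t ω * Complex.I) ∂P := by
    rw [← key (fun ω => ∑ t ∈ s, X t ω) (Finset.aemeasurable_fun_sum _ hm),
      iIndepFun.charFun_map_fun_finsetSum_eq_prod hm (hi.restrict _), Finset.prod_apply]
    exact Finset.prod_congr rfl fun t ht => key _ (hm t ht)
  have h2 : Complex.exp (-((∑ t ∈ s, ∫ ω, X t ω ^ 2 ∂P : ℝ) / 2 : ℂ))
      = ∏ t ∈ s, Complex.exp (-((∫ ω, X t ω ^ 2 ∂P : ℝ) / 2 : ℂ)) := by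
    rw [← Complex.exp_sum]
    congr 1
    push_cast
    rw [Finset.sum_neg_distrib, Finset.sum_div]
  rw [h1, h2]
  refine (norm_prod_sub_prod_le s _ _ ?_ ?_).trans (Finset.sum_le_sum fun t ht =>
    norm_integral_exp_mul_I_sub_le (hX t ht) (h0 t ht))
  · intro t _
    refine (norm_integral_le_integral_norm _).trans ?_
    simp [Complex.norm_exp_ofReal_mul_I]
  · intro t _
    rw [Complex.norm_exp]
    have : 0 ≤ ∫ ω, X t ω ^ 2 ∂P := integral_nonneg fun ω => by positivity
    rw [Real.exp_le_one_iff]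
    simp only [Complex.neg_re, Complex.div_ofNat_re, Complex.ofReal_re]
    linarith

end Lyapunov

/-! ### Self-normalized quadratic forms: truncation and regularization of the denominator -/

section Ratio

/-- The linear combination `∑ s_{kl} b_k b_l / S` of self-normalized products. -/
noncomputable def quadRatio {K : ℕ} (s : Fin K × Fin K → ℝ) (b : ℕ → ℝ) (S : ℝ) : ℝ :=
  ∑ p, s p * (b p.1 * b p.2 / S)

theorem abs_mul_le_sum_sq {b : ℕ → ℝ} {m k l : ℕ} (hk : k < m) (hl : l < m) :
    |b k * b l| ≤ ∑ t ∈ Finset.range m, b t ^ 2 := by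
  have h1 : b k ^ 2 ≤ ∑ t ∈ Finset.range m, b t ^ 2 :=
    Finset.single_le_sum (f := fun t => b t ^ 2) (fun _ _ => sq_nonneg _) (Finset.mem_range.2 hk)
  have h2 : b l ^ 2 ≤ ∑ t ∈ Finset.range m, b t ^ 2 :=
    Finset.single_le_sum (f := fun t => b t ^ 2) (fun _ _ => sq_nonneg _) (Finset.mem_range.2 hl)
  rw [abs_le]
  constructor <;> nlinarith [sq_nonneg (b k + b l), sq_nonneg (b k - b l)]

theorem abs_mul_div_le_one {b : ℕ → ℝ} {m k l : ℕ} {S : ℝ} (hk : k < m) (hl : l < m)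
    (hS : ∑ t ∈ Finset.range m, b t ^ 2 ≤ S) : |b k * b l / S| ≤ 1 := by
  have h := abs_mul_le_sum_sq (b := b) hk hl
  have hS0 : 0 ≤ S := (Finset.sum_nonneg fun _ _ => sq_nonneg _).trans hS
  rw [abs_div, abs_of_nonneg hS0]
  exact div_le_one_of_le₀ (h.trans hS) hS0

/-- With `U` the truncated sum, the difference is the original ratio, at most 1 in absolute value,
times `(δ - (S - U)) / (U + δ)`. The first error term is the price of truncating, the second, where
`U ≥ b 0 ^ 2` is used, the price of adding `δ`. -/
theorem abs_mul_div_sub_le {b : ℕ → ℝ} {m k l : ℕ} {S δ : ℝ} (hk : k < m) (hl : l < m)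
    (hδ : 0 < δ) (hS : ∑ t ∈ Finset.range m, b t ^ 2 ≤ S) :
    |b k * b l / S - b k * b l / (∑ t ∈ Finset.range m, b t ^ 2 + δ)|
      ≤ (S - ∑ t ∈ Finset.range m, b t ^ 2) / δ + δ / (b 0 ^ 2 + δ) := by
  have h := abs_mul_le_sum_sq (b := b) hk hl
  have h0 : b 0 ^ 2 ≤ ∑ t ∈ Finset.range m, b t ^ 2 :=
    Finset.single_le_sum (f := fun t => b t ^ 2) (fun _ _ => sq_nonneg _)
      (Finset.mem_range.2 (by omega))
  set U := ∑ t ∈ Finset.range m, b t ^ 2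
  have hU : 0 ≤ U := (sq_nonneg _).trans h0
  -- If `S = 0` the numerator vanishes too, and both ratios are 0.
  rcases (hU.trans hS).eq_or_lt with hS0 | hS0
  · have hU0 : U = 0 := le_antisymm (hS.trans hS0.symm.le) hU
    have hbb : b k * b l = 0 := abs_eq_zero.1 (le_antisymm (h.trans hU0.le) (abs_nonneg _))
    rw [hbb]
    have : 0 ≤ S - U := by linarith
    simp only [zero_div, sub_zero, abs_zero]
    positivity
  · have hUδ : 0 < U + δ := by positivity
    have e : b k * b l / S - b k * b l / (U + δ) = (b k * b l / S) * ((δ - (S - U)) / (U + δ)) := by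
      field_simp; ring
    rw [e, abs_mul]
    have h1 : |b k * b l / S| ≤ 1 := by
      rw [abs_div, abs_of_pos hS0]; exact div_le_one_of_le₀ (h.trans hS) hS0.le
    have h2 : |(δ - (S - U)) / (U + δ)| ≤ (S - U) / δ + δ / (b 0 ^ 2 + δ) := by
      rw [abs_div, abs_of_pos hUδ]
      have : |δ - (S - U)| ≤ (S - U) + δ := by
        rw [abs_le]; constructor <;> linarith
      refine (div_le_div_of_nonneg_right this hUδ.le).trans ?_
      rw [add_div]
      have hSU : 0 ≤ S - U := by linarith
      gcongr
      linarith
    exact (mul_le_of_le_one_left (abs_nonneg _) h1).trans h2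

theorem abs_quadRatio_le {K m : ℕ} (s : Fin K × Fin K → ℝ) {b : ℕ → ℝ} {S : ℝ} (hK : K ≤ m)
    (hS : ∑ t ∈ Finset.range m, b t ^ 2 ≤ S) : |quadRatio s b S| ≤ ∑ p, |s p| := by
  refine (Finset.abs_sum_le_sum_abs _ _).trans (Finset.sum_le_sum fun p _ => ?_)
  rw [abs_mul]
  exact mul_le_of_le_one_right (abs_nonneg _)
    (abs_mul_div_le_one (p.1.2.trans_le hK) (p.2.2.trans_le hK) hS)

theorem abs_quadRatio_sub_le {K m : ℕ} (s : Fin K × Fin K → ℝ) {b : ℕ → ℝ} {S δ : ℝ}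
    (hK : K ≤ m) (hδ : 0 < δ) (hS : ∑ t ∈ Finset.range m, b t ^ 2 ≤ S) :
    |quadRatio s b S - quadRatio s b (∑ t ∈ Finset.range m, b t ^ 2 + δ)|
      ≤ (∑ p, |s p|) * ((S - ∑ t ∈ Finset.range m, b t ^ 2) / δ + δ / (b 0 ^ 2 + δ)) := by
  unfold quadRatio
  rw [← Finset.sum_sub_distrib, Finset.sum_mul]
  refine (Finset.abs_sum_le_sum_abs _ _).trans (Finset.sum_le_sum fun p _ => ?_)
  rw [← mul_sub, abs_mul]
  exact mul_le_mul_of_nonneg_left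
    (abs_mul_div_sub_le (p.1.2.trans_le hK) (p.2.2.trans_le hK) hδ hS) (abs_nonneg _)

theorem aemeasurable_quadRatio {Ω : Type*} [MeasurableSpace Ω] {P : Measure Ω} {K : ℕ}
    (s : Fin K × Fin K → ℝ) {b : ℕ → Ω → ℝ} {S : Ω → ℝ}
    (hb : ∀ k, AEMeasurable (b k) P) (hS : AEMeasurable S P) :
    AEMeasurable (fun ω => quadRatio s (fun k => b k ω) (S ω)) P := by
  unfold quadRatio
  exact Finset.aemeasurable_fun_sum _ fun p _ => (((hb _).mul (hb _)).div hS).const_mul _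

variable {Ω : Type*} [MeasurableSpace Ω] {P : Measure Ω} [IsProbabilityMeasure P]

/-- The Lipschitz bound on `G` is asked only on the range of the ratios, so that `G x = x ^ 2` is
admissible. -/
theorem abs_integral_quadRatio_sub_le {K m : ℕ} (s : Fin K × Fin K → ℝ) {b : ℕ → Ω → ℝ}
    {S : Ω → ℝ} {δ ρ L : ℝ} {G : ℝ → ℝ} (hb : ∀ k, AEMeasurable (b k) P) (hSm : AEMeasurable S P)
    (hK : K ≤ m) (hδ : 0 < δ) (hL : 0 ≤ L) (hGc : Continuous G)
    (hG : ∀ x y, |x| ≤ ∑ p, |s p| → |y| ≤ ∑ p, |s p| → |G x - G y| ≤ L * |x - y|)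
    (hS : ∀ᵐ ω ∂P, ∑ t ∈ Finset.range m, b t ω ^ 2 ≤ S ω)
    (hi : Integrable (fun ω => S ω - ∑ t ∈ Finset.range m, b t ω ^ 2) P)
    (hρ : ∫ ω, (S ω - ∑ t ∈ Finset.range m, b t ω ^ 2) ∂P ≤ ρ) :
    |∫ ω, G (quadRatio s (fun k => b k ω) (S ω)) ∂P
      - ∫ ω, G (quadRatio s (fun k => b k ω) (∑ t ∈ Finset.range m, b t ω ^ 2 + δ)) ∂P|
      ≤ L * (∑ p, |s p|) * (ρ / δ + ∫ ω, δ / (b 0 ω ^ 2 + δ) ∂P) := by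
  set A := ∑ p, |s p| with hA
  have hA0 : 0 ≤ A := Finset.sum_nonneg fun _ _ => abs_nonneg _
  have hUm : AEMeasurable (fun ω => ∑ t ∈ Finset.range m, b t ω ^ 2 + δ) P :=
    (Finset.aemeasurable_fun_sum _ fun t _ => (hb t).pow_const 2).add_const δ
  have bd : ∀ x, |x| ≤ A → |G x| ≤ |G 0| + L * A := by
    intro x hx
    have h1 := hG x 0 hx (by simpa using hA0)
    have h2 := abs_sub_abs_le_abs_sub (G x) (G 0)
    have h3 : L * |x - 0| ≤ L * A := by gcongr; simpa using hx
    linarith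
  have i1 : Integrable (fun ω => G (quadRatio s (fun k => b k ω) (S ω))) P := by
    refine Integrable.of_bound (C := |G 0| + L * A)
      (hGc.comp_aestronglyMeasurable (aemeasurable_quadRatio s hb hSm).aestronglyMeasurable) ?_
    filter_upwards [hS] with ω hω
    exact bd _ (abs_quadRatio_le s hK hω)
  have i2 : Integrable (fun ω => G (quadRatio s (fun k => b k ω)
      (∑ t ∈ Finset.range m, b t ω ^ 2 + δ))) P := by
    refine Integrable.of_bound (C := |G 0| + L * A)
      (hGc.comp_aestronglyMeasurable (aemeasurable_quadRatio s hb hUm).aestronglyMeasurable) ?_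
    filter_upwards with ω
    exact bd _ (abs_quadRatio_le s hK (by linarith))
  have i3 : Integrable (fun ω => δ / (b 0 ω ^ 2 + δ)) P := by
    refine Integrable.of_bound (C := 1)
      ((aemeasurable_const).div (((hb 0).pow_const 2).add_const δ)).aestronglyMeasurable ?_
    filter_upwards with ω
    have : 0 < b 0 ω ^ 2 + δ := by positivity
    rw [Real.norm_eq_abs, abs_of_nonneg (by positivity)]
    exact div_le_one_of_le₀ (by nlinarith [sq_nonneg (b 0 ω)]) this.le
  rw [← integral_sub i1 i2]
  have h1 : ‖∫ ω, (G (quadRatio s (fun k => b k ω) (S ω)) - G (quadRatio s (fun k => b k ω)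
      (∑ t ∈ Finset.range m, b t ω ^ 2 + δ))) ∂P‖ ≤
      ∫ ω, L * (A * ((S ω - ∑ t ∈ Finset.range m, b t ω ^ 2) / δ + δ / (b 0 ω ^ 2 + δ))) ∂P := by
    refine norm_integral_le_of_norm_le ((((hi.div_const δ).add i3).const_mul A).const_mul L) ?_
    filter_upwards [hS] with ω hω
    refine (hG _ _ (abs_quadRatio_le s hK hω) (abs_quadRatio_le s hK (by linarith))).trans ?_
    exact mul_le_mul_of_nonneg_left (abs_quadRatio_sub_le s hK hδ hω) hL
  refine h1.trans ?_
  rw [integral_const_mul, integral_const_mul, integral_add (hi.div_const δ) i3, integral_div,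
    ← mul_assoc]
  gcongr

/-- `quadRatio` with the truncated and regularized denominator, as a bounded continuous function. -/
theorem exists_boundedContinuousFunction_quadRatio {K m : ℕ} (s : Fin K × Fin K → ℝ) (hK : K ≤ m)
    {δ L : ℝ} (hδ : 0 < δ) (hL : 0 ≤ L) {G : ℝ → ℝ} (hGc : Continuous G)
    (hG : ∀ x y, |x| ≤ ∑ p, |s p| → |y| ≤ ∑ p, |s p| → |G x - G y| ≤ L * |x - y|) :
    ∃ f : BoundedContinuousFunction (EuclideanSpace ℝ (Fin m)) ℝ, ∀ b : ℕ → ℝ,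
      f (WithLp.toLp 2 fun k : Fin m => b k)
        = G (quadRatio s b (∑ t ∈ Finset.range m, b t ^ 2 + δ)) := by
  -- Extension by zero turns a vector into a sequence; only indices below `m` enter, since `K ≤ m`.
  set ext : EuclideanSpace ℝ (Fin m) → ℕ → ℝ := fun x k => if h : k < m then x ⟨k, h⟩ else 0
    with hext
  have hextc : ∀ k, Continuous fun x => ext x k := by
    intro k
    simp only [hext]
    split_ifs
    · fun_prop
    · exact continuous_const
  refine ⟨BoundedContinuousFunction.ofNormedAddCommGroup
    (fun x => G (quadRatio s (ext x) (∑ t ∈ Finset.range m, ext x t ^ 2 + δ))) ?_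
    (|G 0| + L * ∑ p, |s p|) ?_, ?_⟩
  · refine hGc.comp ?_
    unfold quadRatio
    refine continuous_finsetSum _ fun p _ => continuous_const.mul
      (((hextc _).mul (hextc _)).div ?_ fun x => ?_)
    · exact (continuous_finsetSum _ fun t _ => (hextc t).pow 2).add continuous_const
    · have : 0 ≤ ∑ t ∈ Finset.range m, ext x t ^ 2 := Finset.sum_nonneg fun _ _ => sq_nonneg _
      linarith
  · intro x
    have hx : |quadRatio s (ext x) (∑ t ∈ Finset.range m, ext x t ^ 2 + δ)| ≤ ∑ p, |s p| :=
      abs_quadRatio_le s hK (by linarith)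
    have h1 := hG _ 0 hx (by simpa using Finset.sum_nonneg fun _ _ => abs_nonneg _)
    rw [sub_zero] at h1
    have h2 := mul_le_mul_of_nonneg_left hx hL
    rw [Real.norm_eq_abs]
    have h3 := abs_sub_abs_le_abs_sub
      (G (quadRatio s (ext x) (∑ t ∈ Finset.range m, ext x t ^ 2 + δ))) (G 0)
    linarith
  · intro b
    have hb : ∀ k, k < m → ext (WithLp.toLp 2 fun k : Fin m => b k) k = b k := by
      intro k hk
      simp [hext, hk]
    simp only [BoundedContinuousFunction.coe_ofNormedAddCommGroup]
    congr 1
    unfold quadRatio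
    have hs : ∑ t ∈ Finset.range m, ext (WithLp.toLp 2 fun k : Fin m => b k) t ^ 2
        = ∑ t ∈ Finset.range m, b t ^ 2 :=
      Finset.sum_congr rfl fun t ht => by rw [hb t (Finset.mem_range.1 ht)]
    rw [hs]
    refine Finset.sum_congr rfl fun p _ => ?_
    rw [hb _ (p.1.2.trans_le hK), hb _ (p.2.2.trans_le hK)]

/-- Dominated convergence: the integrand is at most 1 and tends to 0 wherever `X ≠ 0`. -/
theorem tendsto_integral_div_sq_add {X : Ω → ℝ} (hX : AEMeasurable X P) (h0 : ∀ᵐ ω ∂P, X ω ≠ 0) :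
    Tendsto (fun δ : ℝ => ∫ ω, δ / (X ω ^ 2 + δ) ∂P) (𝓝[>] 0) (𝓝 0) := by
  have : Tendsto (fun δ : ℝ => ∫ ω, δ / (X ω ^ 2 + δ) ∂P) (𝓝[>] 0) (𝓝 (∫ _, (0 : ℝ) ∂P)) := by
    refine tendsto_integral_filter_of_norm_le_const
      (Eventually.of_forall fun δ => (aemeasurable_const.div
        ((hX.pow_const 2).add_const δ)).aestronglyMeasurable) ⟨1, ?_⟩ ?_
    · filter_upwards [self_mem_nhdsWithin] with δ hδ
      filter_upwards with ω
      have hδ' : (0 : ℝ) < δ := hδ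
      rw [Real.norm_eq_abs, abs_of_nonneg (by positivity)]
      exact div_le_one_of_le₀ (by nlinarith [sq_nonneg (X ω)]) (by positivity)
    · filter_upwards [h0] with ω hω
      have hc : ContinuousAt (fun δ : ℝ => δ / (X ω ^ 2 + δ)) 0 := by
        refine continuousAt_id.div (by fun_prop) ?_
        simpa using hω
      have := hc.tendsto
      simp only [add_zero, zero_div] at this
      exact this.mono_left nhdsWithin_le_nhds
  simpa using this

/-- Convergence of expectations of Lipschitz functions of self-normalized quadratic forms. -/
theorem tendsto_integral_quadRatio {I : Type*} {l : Filter I} {Ω' : Type*} [MeasurableSpace Ω']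
    {P' : Measure Ω'} [IsProbabilityMeasure P'] {K : ℕ} (s : Fin K × Fin K → ℝ)
    {b : I → ℕ → Ω → ℝ} {S : I → Ω → ℝ} {b' : ℕ → Ω' → ℝ} {S' : Ω' → ℝ} {ρ : ℕ → ℝ} {L : ℝ}
    {G : ℝ → ℝ} (hb : ∀ i k, AEMeasurable (b i k) P) (hSm : ∀ i, AEMeasurable (S i) P)
    (hb' : ∀ k, AEMeasurable (b' k) P') (hSm' : AEMeasurable S' P')
    (hL : 0 ≤ L) (hGc : Continuous G)
    (hG : ∀ x y, |x| ≤ ∑ p, |s p| → |y| ≤ ∑ p, |s p| → |G x - G y| ≤ L * |x - y|)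
    (hρ : Tendsto ρ atTop (𝓝 0))
    (hS : ∀ m, ∀ᶠ i in l, (∀ᵐ ω ∂P, ∑ t ∈ Finset.range m, b i t ω ^ 2 ≤ S i ω) ∧
      Integrable (fun ω => S i ω - ∑ t ∈ Finset.range m, b i t ω ^ 2) P ∧
      ∫ ω, (S i ω - ∑ t ∈ Finset.range m, b i t ω ^ 2) ∂P ≤ ρ m)
    (hS' : ∀ m, (∀ᵐ ω ∂P', ∑ t ∈ Finset.range m, b' t ω ^ 2 ≤ S' ω) ∧
      Integrable (fun ω => S' ω - ∑ t ∈ Finset.range m, b' t ω ^ 2) P' ∧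
      ∫ ω, (S' ω - ∑ t ∈ Finset.range m, b' t ω ^ 2) ∂P' ≤ ρ m)
    (hconv : ∀ (m : ℕ) (f : BoundedContinuousFunction (EuclideanSpace ℝ (Fin m)) ℝ),
      Tendsto (fun i => ∫ ω, f (WithLp.toLp 2 fun k : Fin m => b i k ω) ∂P) l
        (𝓝 (∫ ω, f (WithLp.toLp 2 fun k : Fin m => b' k ω) ∂P')))
    (h0 : ∀ᵐ ω ∂P', b' 0 ω ≠ 0) :
    Tendsto (fun i => ∫ ω, G (quadRatio s (fun k => b i k ω) (S i ω)) ∂P) l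
      (𝓝 (∫ ω, G (quadRatio s (fun k => b' k ω) (S' ω)) ∂P')) := by
  set A := ∑ p, |s p| with hA
  have hA0 : 0 ≤ A := Finset.sum_nonneg fun _ _ => abs_nonneg _
  rw [Metric.tendsto_nhds]
  intro e he
  -- Passing to the regularized ratio costs at most `L * A * (2 * e')` on each side, hence at most
  -- `2 * e / 10` each; weak convergence adds `e / 10`, which leaves the total below `e`.
  set e' := e / (10 * (L * A + 1)) with he'
  have he'0 : 0 < e' := by positivity
  have hLA : L * A * e' ≤ e / 10 := by
    rw [he', mul_div_assoc', div_le_div_iff₀ (by positivity) (by norm_num)]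
    nlinarith [mul_nonneg hL hA0]
  obtain ⟨δ, hδ, hδ0⟩ : ∃ δ : ℝ, ∫ ω, δ / (b' 0 ω ^ 2 + δ) ∂P' < e' ∧ 0 < δ :=
    (((tendsto_integral_div_sq_add (hb' 0) h0).eventually_lt_const he'0).and
      self_mem_nhdsWithin).exists
  obtain ⟨m, hmρ, hmK⟩ : ∃ m, ρ m < e' * δ ∧ K + 1 ≤ m :=
    ((hρ.eventually_lt_const (by positivity)).and (eventually_ge_atTop _)).exists
  have hm0 : 0 < m := by omega
  have hρδ : ρ m / δ ≤ e' := by rw [div_le_iff₀ hδ0]; exact hmρ.le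
  obtain ⟨f, hf⟩ := exists_boundedContinuousFunction_quadRatio s (by omega : K ≤ m) hδ0 hL hGc hG
  -- The regularization error is itself the mean of a bounded continuous function of the first
  -- coordinate, so its smallness in the limit carries over to the prelimit; no small-ball estimate
  -- for `b i 0` is needed.
  obtain ⟨g, hg⟩ : ∃ g : BoundedContinuousFunction (EuclideanSpace ℝ (Fin m)) ℝ,
      ∀ x, g x = δ / (x ⟨0, hm0⟩ ^ 2 + δ) := by
    refine ⟨BoundedContinuousFunction.ofNormedAddCommGroup
      (fun x => δ / (x ⟨0, hm0⟩ ^ 2 + δ)) ?_ 1 ?_, fun x => rfl⟩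
    · exact continuous_const.div (by fun_prop) fun x => by positivity
    · intro x
      rw [Real.norm_eq_abs, abs_of_nonneg (by positivity)]
      exact div_le_one_of_le₀ (by nlinarith [sq_nonneg (x ⟨0, hm0⟩)]) (by positivity)
  have c1 := hconv m f
  have c2 := hconv m g
  simp only [fun i ω => hf fun k => b i k ω, fun ω => hf fun k => b' k ω] at c1
  simp only [hg] at c2
  have B' := abs_integral_quadRatio_sub_le s hb' hSm' (by omega : K ≤ m) hδ0 hL hGc hG
    (hS' m).1 (hS' m).2.1 (hS' m).2.2
  have B'' : L * A * (ρ m / δ + ∫ ω, δ / (b' 0 ω ^ 2 + δ) ∂P') ≤ L * A * (2 * e') := by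
    gcongr; linarith
  filter_upwards [hS m, (Metric.tendsto_nhds.1 c1) (e / 10) (by positivity),
    c2.eventually_lt_const hδ] with i hi h1 h2
  have B := abs_integral_quadRatio_sub_le s (hb i) (hSm i) (by omega : K ≤ m) hδ0 hL hGc hG
    hi.1 hi.2.1 hi.2.2
  have B3 : L * A * (ρ m / δ + ∫ ω, δ / (b i 0 ω ^ 2 + δ) ∂P) ≤ L * A * (2 * e') := by
    gcongr; linarith
  rw [Real.dist_eq] at h1 ⊢
  rw [abs_lt] at h1 ⊢
  have B1 := abs_le.1 (B.trans B3)
  have B2 := abs_le.1 (B'.trans B'')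
  constructor <;> linarith [B1.1, B1.2, B2.1, B2.2, h1.1, h1.2]

end Ratio

/-! ### Weak convergence through characteristic functions; independence of rows -/

section Weak

variable {Ω : Type*} [MeasurableSpace Ω] {P : Measure Ω}
  {Ω' : Type*} [MeasurableSpace Ω'] {P' : Measure Ω'}

theorem charFun_map_toLp {κ : Type*} [Fintype κ] {b : κ → Ω → ℝ} (hb : ∀ k, AEMeasurable (b k) P)
    (u : EuclideanSpace ℝ κ) :
    charFun (P.map fun ω => WithLp.toLp 2 fun k => b k ω) u
      = ∫ ω, Complex.exp ((∑ k, u k * b k ω : ℝ) * Complex.I) ∂P := by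
  have hm : AEMeasurable (fun ω => WithLp.toLp 2 fun k => b k ω) P :=
    (WithLp.measurable_toLp 2 _).comp_aemeasurable (aemeasurable_pi_lambda _ hb)
  rw [charFun_apply, integral_map hm (by fun_prop)]
  simp [PiLp.inner_apply]

theorem tendsto_integral_of_tendsto_integral_exp [IsProbabilityMeasure P]
    [IsProbabilityMeasure P'] {I : Type*} {l : Filter I}
    [l.IsCountablyGenerated] {b : I → ℕ → Ω → ℝ} {b' : ℕ → Ω' → ℝ} (m : ℕ)
    (hb : ∀ i k, AEMeasurable (b i k) P) (hb' : ∀ k, AEMeasurable (b' k) P')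
    (h : ∀ u : Fin m → ℝ, Tendsto
      (fun i => ∫ ω, Complex.exp ((∑ k : Fin m, u k * b i k ω : ℝ) * Complex.I) ∂P) l
      (𝓝 (∫ ω, Complex.exp ((∑ k : Fin m, u k * b' k ω : ℝ) * Complex.I) ∂P')))
    (f : BoundedContinuousFunction (EuclideanSpace ℝ (Fin m)) ℝ) :
    Tendsto (fun i => ∫ ω, f (WithLp.toLp 2 fun k : Fin m => b i k ω) ∂P) l
      (𝓝 (∫ ω, f (WithLp.toLp 2 fun k : Fin m => b' k ω) ∂P')) := by
  -- Since `l` is countably generated, it is enough to apply Lévy's continuity theorem along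
  -- sequences.
  refine tendsto_of_seq_tendsto fun x hx => ?_
  have hm : ∀ i, AEMeasurable (fun ω => WithLp.toLp 2 fun k : Fin m => b i k ω) P := fun i =>
    (WithLp.measurable_toLp 2 _).comp_aemeasurable (aemeasurable_pi_lambda _ fun k => hb i k)
  have hm' : AEMeasurable (fun ω => WithLp.toLp 2 fun k : Fin m => b' k ω) P' :=
    (WithLp.measurable_toLp 2 _).comp_aemeasurable (aemeasurable_pi_lambda _ fun k => hb' k)
  have hw : Tendsto (β := ProbabilityMeasure (EuclideanSpace ℝ (Fin m)))
      (fun n => ⟨P.map fun ω => WithLp.toLp 2 fun k : Fin m => b (x n) k ω,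
        Measure.isProbabilityMeasure_map (hm (x n))⟩) atTop
      (𝓝 ⟨P'.map fun ω => WithLp.toLp 2 fun k : Fin m => b' k ω,
        Measure.isProbabilityMeasure_map hm'⟩) := by
    refine ProbabilityMeasure.tendsto_iff_tendsto_charFun.2 fun u => ?_
    have h1 := (h u).comp hx
    rw [← charFun_map_toLp (fun k : Fin m => hb' k)] at h1
    refine h1.congr fun n => ?_
    exact (charFun_map_toLp (fun k : Fin m => hb (x n) k) u).symm
  have h1 : Tendsto (fun n => ∫ y, f y ∂(P.map fun ω => WithLp.toLp 2 fun k : Fin m => b (x n) k ω))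
      atTop (𝓝 (∫ y, f y ∂(P'.map fun ω => WithLp.toLp 2 fun k : Fin m => b' k ω))) :=
    ProbabilityMeasure.tendsto_iff_forall_integral_tendsto.1 hw f
  rw [integral_map hm' f.continuous.aestronglyMeasurable] at h1
  refine h1.congr fun n => ?_
  rw [integral_map (hm (x n)) f.continuous.aestronglyMeasurable]
  rfl

theorem integral_exp_sum_mul_gaussian {τ : Type*} (s : Finset τ) {Z : τ → Ω' → ℝ}
    (hi : iIndepFun Z P') (hZ : ∀ t, HasLaw (Z t) (gaussianReal 0 1) P') (c : τ → ℝ) :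
    ∫ ω, Complex.exp ((∑ t ∈ s, c t * Z t ω : ℝ) * Complex.I) ∂P'
      = Complex.exp (-((∑ t ∈ s, c t ^ 2 : ℝ) / 2 : ℂ)) := by
  have hm : ∀ t, AEMeasurable (fun ω => c t * Z t ω) P' := fun t => (hZ t).aemeasurable.const_mul _
  have key : ∀ Y : Ω' → ℝ, AEMeasurable Y P' →
      charFun (P'.map Y) 1 = ∫ ω, Complex.exp (Y ω * Complex.I) ∂P' := by
    intro Y hY
    rw [charFun_apply_real, integral_map hY (by fun_prop)]
    simp
  have hi' : iIndepFun (fun t ω => c t * Z t ω) P' :=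
    hi.comp (fun t x => c t * x) fun t => by fun_prop
  rw [← key (fun ω => ∑ t ∈ s, c t * Z t ω) (Finset.aemeasurable_fun_sum _ fun t _ => hm t),
    iIndepFun.charFun_map_fun_finsetSum_eq_prod (X := fun t ω => c t * Z t ω) (fun t _ => hm t)
      (hi'.restrict _), Finset.prod_apply]
  have h2 : Complex.exp (-((∑ t ∈ s, c t ^ 2 : ℝ) / 2 : ℂ))
      = ∏ t ∈ s, Complex.exp (-(c t ^ 2 / 2 : ℂ)) := by
    rw [← Complex.exp_sum]
    congr 1
    push_cast
    rw [Finset.sum_neg_distrib, Finset.sum_div]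
  rw [h2]
  refine Finset.prod_congr rfl fun t _ => ?_
  rw [key _ (hm t)]
  have h3 : charFun (P'.map (Z t)) (c t) = ∫ ω, Complex.exp ((c t * Z t ω : ℝ) * Complex.I) ∂P' := by
    rw [charFun_apply_real, integral_map (hZ t).aemeasurable (by fun_prop)]
    simp
  rw [← h3, (hZ t).map_eq, charFun_gaussianReal]
  simp

/-- The rows of a doubly indexed family of independent variables are independent. -/
theorem iIndepFun_rows [IsProbabilityMeasure P] {ι τ : Type*} {X : ι → τ → Ω → ℝ} (hm : ∀ i t, Measurable (X i t))
    (h : iIndepFun (fun p : ι × τ => X p.1 p.2) P) :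
    iIndepFun (fun i ω => fun t => X i t ω) P := by
  have hs : iIndepFun (fun p : (_ : ι) × τ => X p.1 p.2) P :=
    h.precomp (Equiv.sigmaEquivProd ι τ).injective
  have hr : ∀ i, iIndepFun (X i) P := fun i =>
    h.precomp (g := fun t => (i, t)) fun a b hab => by simpa using hab
  have : ∀ i t, IsProbabilityMeasure (P.map (X i t)) :=
    fun i t => Measure.isProbabilityMeasure_map (hm i t).aemeasurable
  have hY : Measurable fun ω => fun p : (_ : ι) × τ => X p.1 p.2 ω :=
    measurable_pi_iff.2 fun p => hm p.1 p.2
  -- The joint law of the rows is the curried form of the product law of all entries, hence a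
  -- product of row laws.
  have e : P.map (fun ω i t => X i t ω) = (P.map fun ω => fun p : (_ : ι) × τ => X p.1 p.2 ω).map
      (MeasurableEquiv.piCurry fun (_ : ι) (_ : τ) => ℝ) := by
    rw [Measure.map_map (MeasurableEquiv.measurable _) hY]
    congr 1
  have e2 : (P.map fun ω => fun p : (_ : ι) × τ => X p.1 p.2 ω)
      = Measure.infinitePi fun p : (_ : ι) × τ => P.map (X p.1 p.2) :=
    (iIndepFun_iff_map_fun_eq_infinitePi_map
      fun p : (_ : ι) × τ => hm p.1 p.2).1 hs
  rw [iIndepFun_iff_map_fun_eq_infinitePi_map (fun i => measurable_pi_iff.2 (hm i)), e, e2,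
    Measure.infinitePi_map_piCurry (fun i t => P.map (X i t))]
  congr 1
  funext i
  rw [(iIndepFun_iff_map_fun_eq_infinitePi_map (hm i)).1 (hr i)]

end Weak

/-! ### The vectors `v_k` and the weights `σ_k` -/

section Trig

theorem sum_Icc_one_eq_sum_range {M : Type*} [AddCommMonoid M] (f : ℕ → M) (T : ℕ) :
    ∑ t ∈ Finset.Icc 1 T, f t = ∑ s ∈ Finset.range T, f (s + 1) := by
  induction T with
  | zero => simp
  | succ n ih => rw [Finset.sum_Icc_succ_top (by omega), ih, Finset.sum_range_succ]

/-- Telescoping of `2 sin θ cos (2sθ) = sin ((2s + 1)θ) - sin ((2s - 1)θ)`. -/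
theorem two_mul_sin_mul_sum_cos (θ : ℝ) (n : ℕ) :
    2 * Real.sin θ * ∑ s ∈ Finset.range n, Real.cos (2 * s * θ)
      = Real.sin ((2 * n - 1) * θ) + Real.sin θ := by
  induction n with
  | zero => simp
  | succ n ih =>
    rw [Finset.sum_range_succ, mul_add, ih]
    have h1 : ((2 * ((n + 1 : ℕ) : ℝ) - 1) * θ) = 2 * n * θ + θ := by push_cast; ring
    have h2 : ((2 * (n : ℝ) - 1) * θ) = 2 * n * θ - θ := by ring
    rw [h1, h2, Real.sin_add, Real.sin_sub]
    ring

theorem sum_cos_pi_mul_div {m : ℤ} {T : ℕ} (h0 : m ≠ 0) (h1 : |m| < 2 * T) :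
    ∑ s ∈ Finset.range T, Real.cos (Real.pi * m * s / T) = (1 - Real.cos (Real.pi * m)) / 2 := by
  have hT : (0 : ℝ) < T := by
    have : (0 : ℤ) < 2 * T := (abs_nonneg m).trans_lt h1
    exact_mod_cast (by omega : 0 < T)
  set θ : ℝ := Real.pi * m / (2 * T) with hθ
  have hm : |(m : ℝ)| < 2 * T := by exact_mod_cast h1
  have hs : Real.sin θ ≠ 0 := by
    rw [abs_lt] at hm
    rw [Ne, Real.sin_eq_zero_iff_of_lt_of_lt]
    · rw [hθ]
      have : (m : ℝ) ≠ 0 := by exact_mod_cast h0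
      have := Real.pi_ne_zero
      positivity
    · rw [hθ, lt_div_iff₀ (by positivity)]
      nlinarith [Real.pi_pos]
    · rw [hθ, div_lt_iff₀ (by positivity)]
      nlinarith [Real.pi_pos]
  have h := two_mul_sin_mul_sum_cos θ T
  have e1 : ∀ s : ℕ, (2 * s * θ : ℝ) = Real.pi * m * s / T := by
    intro s; rw [hθ]; field_simp
  have e2 : (2 * T - 1) * θ = m * Real.pi - θ := by
    rw [hθ]; field_simp
  simp only [e1] at h
  rw [e2, Real.sin_sub, Real.sin_int_mul_pi] at h
  have h3 : 2 * Real.sin θ * ∑ s ∈ Finset.range T, Real.cos (Real.pi * m * s / T)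
      = 2 * Real.sin θ * ((1 - Real.cos (Real.pi * m)) / 2) := by
    rw [h, mul_comm Real.pi]; ring
  exact mul_left_cancel₀ (by simpa using hs) h3

theorem vCoord_succ (T k s : ℕ) :
    vCoord T k (s + 1) = Real.sqrt (2 / T) * Real.sin (Real.pi * k * s / T) := by
  simp [vCoord]

theorem abs_vCoord_le (T k t : ℕ) : |vCoord T k t| ≤ Real.sqrt (2 / T) := by
  unfold vCoord
  rw [abs_mul, abs_of_nonneg (Real.sqrt_nonneg _)]
  exact mul_le_of_le_one_right (Real.sqrt_nonneg _) (Real.abs_sin_le_one _)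

/-- The product of sines splits into cosines of frequencies `k - l` and `k + l`. These have the same
parity, so for `k ≠ l` the two cosine sums are equal and cancel; for `k = l` they are `T` and 0. -/
theorem sum_vCoord_mul_vCoord {T k l : ℕ} (hk : 1 ≤ k) (hl : 1 ≤ l) (hkT : k < T) (hlT : l < T) :
    ∑ s ∈ Finset.range T, vCoord T k (s + 1) * vCoord T l (s + 1) = if k = l then 1 else 0 := by
  have hT : (0 : ℝ) < T := by exact_mod_cast (by omega : 0 < T)
  have e : ∀ s : ℕ, vCoord T k (s + 1) * vCoord T l (s + 1)
      = 1 / T * (Real.cos (Real.pi * ((k - l : ℤ) : ℝ) * s / T)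
          - Real.cos (Real.pi * ((k + l : ℤ) : ℝ) * s / T)) := by
    intro s
    rw [vCoord_succ, vCoord_succ]
    have h1 : Real.pi * ((k - l : ℤ) : ℝ) * s / T
        = Real.pi * k * s / T - Real.pi * l * s / T := by push_cast; ring
    have h2 : Real.pi * ((k + l : ℤ) : ℝ) * s / T
        = Real.pi * k * s / T + Real.pi * l * s / T := by push_cast; ring
    rw [h1, h2, Real.cos_sub, Real.cos_add]
    have h3 : Real.sqrt (2 / T) * Real.sqrt (2 / T) = 2 / T := Real.mul_self_sqrt (by positivity)
    linear_combination (Real.sin (Real.pi * k * s / T) * Real.sin (Real.pi * l * s / T)) * h3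
  have h2 := sum_cos_pi_mul_div (m := (k + l : ℤ)) (T := T) (by omega) (by
    rw [abs_of_nonneg (by omega)]; omega)
  simp only [e]
  rw [← Finset.mul_sum, Finset.sum_sub_distrib, h2]
  split_ifs with h
  · subst h
    have : Real.cos (Real.pi * ((k + k : ℤ) : ℝ)) = 1 := by
      rw [← Real.cos_nat_mul_two_pi k]; congr 1; push_cast; ring
    rw [this]
    simp [hT.ne']
  · have h1 := sum_cos_pi_mul_div (m := (k - l : ℤ)) (T := T) (by omega) (by
      rw [abs_lt]; omega)
    have : Real.cos (Real.pi * ((k + l : ℤ) : ℝ)) = Real.cos (Real.pi * ((k - l : ℤ) : ℝ)) := by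
      rw [← Real.cos_add_nat_mul_two_pi (Real.pi * ((k - l : ℤ) : ℝ)) l]; congr 1; push_cast; ring
    rw [h1, this]; simp

theorem abs_vCoord_succ_sub_le (T k s : ℕ) :
    |vCoord T k (s + 1 + 1) - vCoord T k (s + 1)| ≤ Real.sqrt (2 / T) * (Real.pi * k / T) := by
  rw [vCoord_succ, vCoord_succ, ← mul_sub, abs_mul, abs_of_nonneg (Real.sqrt_nonneg _)]
  refine mul_le_mul_of_nonneg_left ?_ (Real.sqrt_nonneg _)
  have h : |Real.sin (Real.pi * k * ((s + 1 : ℕ) : ℝ) / T) - Real.sin (Real.pi * k * s / T)|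
      ≤ |Real.pi * k * ((s + 1 : ℕ) : ℝ) / T - Real.pi * k * s / T| := by
    simpa [Real.dist_eq] using Real.lipschitzWith_sin.dist_le_mul
      (Real.pi * k * ((s + 1 : ℕ) : ℝ) / T) (Real.pi * k * s / T)
  refine h.trans (le_of_eq ?_)
  have : Real.pi * k * ((s + 1 : ℕ) : ℝ) / T - Real.pi * k * s / T = Real.pi * k / T := by
    push_cast; ring
  rw [this, abs_of_nonneg (by have := Real.pi_pos; positivity)]

theorem sum_sub_succ_mul (x w : ℕ → ℝ) (N : ℕ) :
    ∑ s ∈ Finset.range (N + 1), (x s - x (s + 1)) * w s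
      = x 0 * w 0 - x (N + 1) * w N + ∑ s ∈ Finset.range N, x (s + 1) * (w (s + 1) - w s) := by
  induction N with
  | zero => simp; ring
  | succ n ih => rw [Finset.sum_range_succ, ih, Finset.sum_range_succ _ n]; ring

/-- An upper bound for the total variation of the vector `v_k`, extended by zero. -/
noncomputable def vVariation (T k : ℕ) : ℝ := Real.sqrt (2 / T) * (2 + Real.pi * k)

theorem tendsto_vVariation (k : ℕ) : Tendsto (fun T => vVariation T k) atTop (𝓝 0) := by
  have h1 : Tendsto (fun T : ℕ => (2 : ℝ) / T) atTop (𝓝 0) :=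
    tendsto_const_div_atTop_nhds_zero_nat 2
  have h2 := (Real.continuous_sqrt.tendsto 0).comp h1
  rw [Real.sqrt_zero] at h2
  simpa [vVariation] using h2.mul_const (2 + Real.pi * k)

theorem abs_vCoord_add_variation_le {N k : ℕ} :
    |vCoord (N + 1) k 1| + |vCoord (N + 1) k (N + 1)|
      + ∑ s ∈ Finset.range N, |vCoord (N + 1) k (s + 1 + 1) - vCoord (N + 1) k (s + 1)|
      ≤ vVariation (N + 1) k := by
  have h1 : ∑ s ∈ Finset.range N, |vCoord (N + 1) k (s + 1 + 1) - vCoord (N + 1) k (s + 1)|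
      ≤ Real.sqrt (2 / (N + 1 : ℕ)) * (Real.pi * k) := by
    refine (Finset.sum_le_sum fun s _ => abs_vCoord_succ_sub_le (N + 1) k s).trans ?_
    rw [Finset.sum_const, Finset.card_range, nsmul_eq_mul]
    have hp := Real.pi_pos
    have : (N : ℝ) * (Real.pi * k / (N + 1 : ℕ)) ≤ Real.pi * k := by
      rw [mul_div_assoc', div_le_iff₀ (by positivity)]
      push_cast
      nlinarith [mul_nonneg hp.le (Nat.cast_nonneg (α := ℝ) k)]
    nlinarith [Real.sqrt_nonneg (2 / ((N + 1 : ℕ) : ℝ))]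
  have h2 := abs_vCoord_le (N + 1) k 1
  have h3 := abs_vCoord_le (N + 1) k (N + 1)
  unfold vVariation
  linarith

theorem sigma_pos {T k : ℕ} (hk : 1 ≤ k) (hkT : k < T) : 0 < sigma T k := by
  have hT : (0 : ℝ) < T := by exact_mod_cast (by omega : 0 < T)
  have hk' : (0 : ℝ) < k := by exact_mod_cast hk
  have hkT' : (k : ℝ) < T := by exact_mod_cast hkT
  rw [sigma, if_pos hkT, inv_pos]
  have := Real.sin_pos_of_pos_of_lt_pi (x := Real.pi * k / (2 * T)) (by positivity) (by
    rw [div_lt_iff₀ (by positivity)]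
    nlinarith [Real.pi_pos])
  positivity

/-- Jordan's inequality `sin x ≥ 2x / π` on `[0, π/2]`. The bound holds for all `k < T`, as the tail
of the denominator requires. -/
theorem sigma_le {T k : ℕ} (hk : 1 ≤ k) (hkT : k < T) : sigma T k ≤ T / (2 * k) := by
  have hT : (0 : ℝ) < T := by exact_mod_cast (by omega : 0 < T)
  have hk' : (0 : ℝ) < k := by exact_mod_cast hk
  have hkT' : (k : ℝ) < T := by exact_mod_cast hkT
  rw [sigma, if_pos hkT]
  have h := Real.mul_le_sin (x := Real.pi * k / (2 * T)) (by positivity) (by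
    rw [div_le_div_iff₀ (by positivity) (by norm_num)]
    nlinarith [Real.pi_pos])
  have e : 2 / Real.pi * (Real.pi * k / (2 * T)) = k / T := by
    have := Real.pi_ne_zero
    field_simp
  rw [e] at h
  rw [inv_le_comm₀ (by have : 0 < (k : ℝ) / T := by positivity
                       linarith) (by positivity), inv_div]
  calc (2 * k / T : ℝ) = 2 * (k / T) := by ring
    _ ≤ _ := by linarith

theorem tendsto_pi_div_mul_sigma {k : ℕ} (hk : 1 ≤ k) :
    Tendsto (fun T : ℕ => Real.pi / T * sigma T k) atTop (𝓝 (1 / k)) := by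
  have hk' : (0 : ℝ) < k := by exact_mod_cast hk
  have hp := Real.pi_pos
  have h0 : Tendsto (fun T : ℕ => Real.pi * k / 2 / (T : ℝ)) atTop (𝓝 0) :=
    tendsto_const_div_atTop_nhds_zero_nat _
  have h1 : Tendsto (fun T : ℕ => Real.sinc (Real.pi * k / 2 / (T : ℝ))) atTop (𝓝 1) := by
    have := (Real.continuous_sinc.tendsto 0).comp h0
    rwa [Real.sinc_zero] at this
  have h2 : Tendsto (fun T : ℕ => (k * Real.sinc (Real.pi * k / 2 / (T : ℝ)))⁻¹) atTop
      (𝓝 (k * 1)⁻¹) := (h1.const_mul _).inv₀ (by simpa using hk'.ne')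
  rw [mul_one, ← one_div] at h2
  refine h2.congr' ?_
  filter_upwards [eventually_gt_atTop k] with T hT
  have hT' : (0 : ℝ) < T := by exact_mod_cast (by omega : 0 < T)
  have hx : Real.pi * k / 2 / (T : ℝ) ≠ 0 := by positivity
  rw [sigma, if_pos hT, Real.sinc_of_ne_zero hx]
  have e : Real.pi * k / (2 * T) = Real.pi * k / 2 / T := by field_simp
  rw [e]
  field_simp

end Trig

/-! ### Random series: first and second moment bounds -/

section Series

variable {Ω : Type*} [MeasurableSpace Ω] {P : Measure Ω}

/-- A series of integrable functions with summable `L¹` bounds. -/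
theorem summable_integrable_tsum_of_integral_abs_le {F : ℕ → Ω → ℝ} {c : ℕ → ℝ}
    (hF : ∀ k, Integrable (F k) P) (hc : ∀ k, ∫ ω, |F k ω| ∂P ≤ c k) (hs : Summable c) :
    (∀ᵐ ω ∂P, Summable fun k => |F k ω|) ∧ Integrable (fun ω => ∑' k, |F k ω|) P ∧
      ∫ ω, ∑' k, |F k ω| ∂P ≤ ∑' k, c k := by
  have hn : Summable fun k => ∫ ω, ‖|F k ω|‖ ∂P := by
    refine hs.of_nonneg_of_le (fun k => integral_nonneg fun ω => norm_nonneg _) fun k => ?_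
    simpa using hc k
  have hE : ∑' k, ∫⁻ ω, ‖F k ω‖ₑ ∂P ≠ ⊤ := by
    have e : ∀ k, ∫⁻ ω, ‖F k ω‖ₑ ∂P = ENNReal.ofReal (∫ ω, ‖F k ω‖ ∂P) := fun k =>
      (ofReal_integral_norm_eq_lintegral_enorm (hF k)).symm
    simp only [e]
    have hn' : Summable fun k => ∫ ω, ‖F k ω‖ ∂P := by simpa using hn
    exact hn'.tsum_ofReal_ne_top
  have hS : ∀ᵐ ω ∂P, Summable fun k => |F k ω| := by
    rw [← lintegral_tsum fun k => (hF k).aestronglyMeasurable.enorm] at hE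
    filter_upwards [ae_lt_top' (AEMeasurable.tsum
      fun k => (hF k).aestronglyMeasurable.enorm) hE] with ω hω
    exact tsum_enorm_ne_top_iff_summable_norm.1 hω.ne
  have hI := hasSum_integral_of_summable_integral_norm (fun k => (hF k).abs) hn
  refine ⟨hS, ?_, ?_⟩
  · refine ⟨(AEMeasurable.tsum fun k =>
      (hF k).abs.aestronglyMeasurable.aemeasurable).aestronglyMeasurable, ?_⟩
    refine lt_of_le_of_lt (lintegral_mono fun ω => enorm_tsum_le_tsum_enorm) ?_
    rw [lintegral_tsum fun k => (hF k).abs.aestronglyMeasurable.enorm]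
    simpa using hE.lt_top
  · rw [← hI.tsum_eq]
    exact hI.summable.tsum_le_tsum hc hs

theorem integral_abs_tsum_le {F : ℕ → Ω → ℝ} {c : ℕ → ℝ}
    (hF : ∀ k, Integrable (F k) P) (hc : ∀ k, ∫ ω, |F k ω| ∂P ≤ c k) (hs : Summable c) :
    Integrable (fun ω => ∑' k, F k ω) P ∧ ∫ ω, |∑' k, F k ω| ∂P ≤ ∑' k, c k := by
  obtain ⟨h1, h2, h3⟩ := summable_integrable_tsum_of_integral_abs_le hF hc hs
  have hle : ∀ᵐ ω ∂P, |∑' k, F k ω| ≤ ∑' k, |F k ω| := by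
    filter_upwards [h1] with ω hω
    simp only [← Real.norm_eq_abs] at hω ⊢
    exact norm_tsum_le_tsum_norm hω
  have hm : AEStronglyMeasurable (fun ω => ∑' k, F k ω) P :=
    (AEMeasurable.tsum fun k => (hF k).aestronglyMeasurable.aemeasurable).aestronglyMeasurable
  have hi : Integrable (fun ω => ∑' k, F k ω) P := h2.mono' hm hle
  exact ⟨hi, (integral_mono_ae hi.abs h2 hle).trans h3⟩

/-- Cauchy–Schwarz with the weights `|a k|`, on partial sums and then in the limit. -/
theorem sq_tsum_mul_le {a g : ℕ → ℝ} (ha : Summable fun k => |a k|)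
    (hg : Summable fun k => |a k| * g k ^ 2) :
    (∑' k, a k * g k) ^ 2 ≤ (∑' k, |a k|) * ∑' k, |a k| * g k ^ 2 := by
  have hs : Summable fun k => a k * g k := by
    refine Summable.of_norm_bounded (ha.add hg) fun k => ?_
    rw [Real.norm_eq_abs, abs_mul]
    nlinarith [abs_nonneg (a k), sq_abs (g k), sq_nonneg (|g k| - 1), abs_nonneg (g k),
      mul_nonneg (abs_nonneg (a k)) (sq_nonneg (|g k| - 1)),
      mul_nonneg (abs_nonneg (a k)) (sq_nonneg (g k))]
  refine le_of_tendsto_of_tendsto' (hs.hasSum.tendsto_sum_nat.pow 2)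
    (ha.hasSum.tendsto_sum_nat.mul hg.hasSum.tendsto_sum_nat) fun n => ?_
  refine Finset.sum_sq_le_sum_mul_sum_of_sq_le_mul _ (fun k _ => abs_nonneg _)
    (fun k _ => by positivity) fun k _ => ?_
  rw [mul_pow, ← mul_assoc, ← sq_abs (a k), sq |a k|]

theorem integral_sq_tsum_le {a : ℕ → ℝ} {G : ℕ → Ω → ℝ} {v : ℝ}
    (ha : Summable fun k => |a k|) (hm : ∀ k, AEMeasurable (G k) P)
    (hG : ∀ k, Integrable (fun ω => G k ω ^ 2) P) (hv : ∀ k, ∫ ω, G k ω ^ 2 ∂P ≤ v) :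
    Integrable (fun ω => (∑' k, a k * G k ω) ^ 2) P ∧
      ∫ ω, (∑' k, a k * G k ω) ^ 2 ∂P ≤ (∑' k, |a k|) ^ 2 * v := by
  obtain ⟨h1, h2, h3⟩ := summable_integrable_tsum_of_integral_abs_le
    (F := fun k ω => |a k| * G k ω ^ 2) (c := fun k => |a k| * v)
    (fun k => (hG k).const_mul _) (fun k => by
      have : ∀ ω, |(|a k| * G k ω ^ 2)| = |a k| * G k ω ^ 2 := fun ω =>
        abs_of_nonneg (by positivity)
      simp only [this]
      rw [integral_const_mul]
      exact mul_le_mul_of_nonneg_left (hv k) (abs_nonneg _)) (ha.mul_right v)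
  have e : ∀ k ω, |(|a k| * G k ω ^ 2)| = |a k| * G k ω ^ 2 := fun k ω =>
    abs_of_nonneg (by positivity)
  simp only [e] at h1 h2 h3
  rw [tsum_mul_right] at h3
  have hle : ∀ᵐ ω ∂P, (∑' k, a k * G k ω) ^ 2
      ≤ (∑' k, |a k|) * ∑' k, |a k| * G k ω ^ 2 := by
    filter_upwards [h1] with ω hω
    exact sq_tsum_mul_le ha hω
  have hmeas : AEStronglyMeasurable (fun ω => (∑' k, a k * G k ω) ^ 2) P :=
    ((AEMeasurable.tsum fun k => (hm k).const_mul (a k)).pow_const 2).aestronglyMeasurable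
  have hi : Integrable (fun ω => (∑' k, a k * G k ω) ^ 2) P := by
    refine (h2.const_mul (∑' k, |a k|)).mono' hmeas ?_
    filter_upwards [hle] with ω hω
    rw [Real.norm_eq_abs, abs_of_nonneg (sq_nonneg _)]
    exact hω
  refine ⟨hi, (integral_mono_ae hi (h2.const_mul _) hle).trans ?_⟩
  rw [integral_const_mul, sq, mul_assoc]
  exact mul_le_mul_of_nonneg_left h3 (tsum_nonneg fun k => abs_nonneg _)

end Series

/-! ### Moments of white noise -/

section Noise

variable {Ω : Type*} [MeasurableSpace Ω] {P : Measure Ω} [IsProbabilityMeasure P]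

/-- Independent centred noise of unit variance with fourth moments bounded by `κ`. -/
structure IsWhiteNoise (P : Measure Ω) (κ : ℝ) (η : ℤ → Ω → ℝ) : Prop where
  measurable : ∀ t, Measurable (η t)
  indep : iIndepFun η P
  mean_zero : ∀ t, ∫ ω, η t ω ∂P = 0
  var_one : ∀ t, ∫ ω, η t ω ^ 2 ∂P = 1
  memLp : ∀ t, MemLp (η t) 4 P
  fourth_moment : ∀ t, ∫ ω, η t ω ^ 4 ∂P ≤ κ

namespace IsWhiteNoise

variable {κ : ℝ} {η : ℤ → Ω → ℝ}

theorem integrable (h : IsWhiteNoise P κ η) (t : ℤ) : Integrable (η t) P :=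
  (h.memLp t).integrable (by norm_num)

theorem memLp_two (h : IsWhiteNoise P κ η) (t : ℤ) : MemLp (η t) 2 P :=
  (h.memLp t).mono_exponent (by norm_num)

theorem integral_abs_le (h : IsWhiteNoise P κ η) (t : ℤ) : ∫ ω, |η t ω| ∂P ≤ 1 := by
  have i2 : Integrable (fun ω => η t ω ^ 2) P := (h.memLp_two t).integrable_sq
  have h1 : ∫ ω, |η t ω| ∂P ≤ ∫ ω, (1 + η t ω ^ 2) / 2 ∂P := by
    refine integral_mono (h.integrable t).abs (((integrable_const _).add i2).div_const 2)
      fun ω => ?_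
    have := sq_abs (η t ω)
    nlinarith [sq_nonneg (|η t ω| - 1)]
  rw [integral_div, integral_add (integrable_const _) i2, h.var_one t] at h1
  simpa using h1

theorem integral_abs_pow_three_le (h : IsWhiteNoise P κ η) (t : ℤ) :
    ∫ ω, |η t ω| ^ 3 ∂P ≤ 1 + κ := by
  have i2 : Integrable (fun ω => η t ω ^ 2) P := (h.memLp_two t).integrable_sq
  have i3 : Integrable (fun ω => |η t ω| ^ 3) P := by
    simpa using ((h.memLp t).mono_exponent (p := 3) (by norm_num)).integrable_norm_pow
      (by norm_num)
  have i4 : Integrable (fun ω => η t ω ^ 4) P := by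
    have := (h.memLp t).integrable_norm_pow (by norm_num)
    simpa [Even.pow_abs (show Even 4 by decide)] using this
  have h1 : ∫ ω, |η t ω| ^ 3 ∂P ≤ ∫ ω, (η t ω ^ 2 + η t ω ^ 4) ∂P := by
    refine integral_mono i3 (i2.add i4) fun ω => ?_
    have e2 := sq_abs (η t ω)
    have e4 : |η t ω| ^ 4 = η t ω ^ 4 := Even.pow_abs (by decide) _
    simp only [← e2, ← e4]
    nlinarith [sq_nonneg (|η t ω| * (|η t ω| - 1)), sq_nonneg (|η t ω|), sq_nonneg (|η t ω| ^ 2)]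
  rw [integral_add i2 i4, h.var_one t] at h1
  linarith [h.fourth_moment t]

theorem integral_sq_sum (h : IsWhiteNoise P κ η) (s : Finset ℕ) (c : ℕ → ℝ) {f : ℕ → ℤ}
    (hf : Function.Injective f) :
    Integrable (fun ω => (∑ t ∈ s, c t * η (f t) ω) ^ 2) P ∧
      ∫ ω, (∑ t ∈ s, c t * η (f t) ω) ^ 2 ∂P = ∑ t ∈ s, c t ^ 2 := by
  have hm : ∀ t, MemLp (fun ω => c t * η (f t) ω) 2 P := fun t => (h.memLp_two _).const_mul _
  have hS : MemLp (fun ω => ∑ t ∈ s, c t * η (f t) ω) 2 P := memLp_finsetSum _ fun t _ => hm t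
  refine ⟨hS.integrable_sq, ?_⟩
  have h0 : ∫ ω, ∑ t ∈ s, c t * η (f t) ω ∂P = 0 := by
    rw [integral_finsetSum _ fun t _ => (hm t).integrable (by norm_num)]
    refine Finset.sum_eq_zero fun t _ => ?_
    rw [integral_const_mul, h.mean_zero, mul_zero]
  have hv := variance_eq_sub hS
  have hi : iIndepFun (fun t ω => c t * η (f t) ω) P :=
    (h.indep.precomp hf).comp (fun t x => c t * x) fun t => by fun_prop
  have hvs := IndepFun.variance_sum (s := s) (X := fun t ω => c t * η (f t) ω) (μ := P)
    (fun t _ => hm t) (fun i _ j _ hij => hi.indepFun hij)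
  have e : (∑ t ∈ s, fun ω => c t * η (f t) ω) = fun ω => ∑ t ∈ s, c t * η (f t) ω := by
    ext; simp
  rw [e, hv, h0] at hvs
  simp only [Pi.pow_apply] at hvs
  rw [zero_pow (by norm_num), sub_zero] at hvs
  rw [hvs]
  refine Finset.sum_congr rfl fun t _ => ?_
  rw [variance_const_mul, variance_eq_sub (h.memLp_two _), h.mean_zero]
  simp [h.var_one]

end IsWhiteNoise

end Noise

/-! ### Linear filters and their products with `v_k` -/

section Path

/-- The output `∑ᵢ ψᵢ x_{t-i}` of the linear filter `ψ` on the path `x`. -/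
noncomputable def filterPath (ψ : ℕ → ℝ) (x : ℤ → ℝ) (t : ℤ) : ℝ := ∑' i : ℕ, ψ i * x (t - i)

/-- The product of the filtered path with `v_k`. -/
noncomputable def pathDot (ψ : ℕ → ℝ) (T k : ℕ) (x : ℤ → ℝ) : ℝ :=
  ∑ t ∈ Finset.Icc 1 T, filterPath ψ x t * vCoord T k t

/-- The product of the path, delayed by `i`, with `v_k`. -/
noncomputable def shiftDot (T k : ℕ) (i : ℤ) (x : ℤ → ℝ) : ℝ :=
  ∑ s ∈ Finset.range T, vCoord T k (s + 1) * x ((s + 1 : ℕ) - i)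

/-- The bounds on the lag coefficients of a single row. -/
structure IsLag (b B : ℝ) (ψ : ℕ → ℝ) : Prop where
  summable : Summable fun k : ℕ => (1 + (k : ℝ)) * |ψ k|
  tsum_le : ∑' k : ℕ, (1 + (k : ℝ)) * |ψ k| ≤ B
  le_abs_tsum : b ≤ |∑' k : ℕ, ψ k|

namespace IsLag

variable {b B : ℝ} {ψ : ℕ → ℝ}

theorem summable_abs (h : IsLag b B ψ) : Summable fun k => |ψ k| :=
  h.summable.of_nonneg_of_le (fun _ => abs_nonneg _) fun k => by
    nlinarith [abs_nonneg (ψ k), mul_nonneg (Nat.cast_nonneg (α := ℝ) k) (abs_nonneg (ψ k))]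

theorem tsum_abs_le (h : IsLag b B ψ) : ∑' k, |ψ k| ≤ B :=
  (h.summable_abs.tsum_le_tsum (fun k => by
    nlinarith [abs_nonneg (ψ k), mul_nonneg (Nat.cast_nonneg (α := ℝ) k) (abs_nonneg (ψ k))])
    h.summable).trans h.tsum_le

theorem summable_mul (h : IsLag b B ψ) : Summable fun k : ℕ => (k : ℝ) * |ψ k| :=
  h.summable.of_nonneg_of_le (fun _ => by positivity) fun k => by
    nlinarith [abs_nonneg (ψ k)]

theorem tsum_mul_le (h : IsLag b B ψ) : ∑' k : ℕ, (k : ℝ) * |ψ k| ≤ B :=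
  (h.summable_mul.tsum_le_tsum (fun k => by nlinarith [abs_nonneg (ψ k)]) h.summable).trans
    h.tsum_le

end IsLag

theorem measurable_pathDot (ψ : ℕ → ℝ) (T k : ℕ) : Measurable (pathDot ψ T k) := by
  unfold pathDot filterPath
  refine Finset.measurable_fun_sum _ fun t _ => Measurable.mul_const ?_ _
  exact Measurable.tsum fun i => (measurable_pi_apply _).const_mul _

theorem pathDot_eq_tsum {ψ : ℕ → ℝ} {x : ℤ → ℝ}
    (h : ∀ t : ℤ, Summable fun i : ℕ => ψ i * x (t - i)) (T k : ℕ) :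
    (Summable fun i : ℕ => ψ i * shiftDot T k i x) ∧
      pathDot ψ T k x = ∑' i : ℕ, ψ i * shiftDot T k i x := by
  have e : ∀ i : ℕ, ψ i * shiftDot T k i x
      = ∑ s ∈ Finset.range T, vCoord T k (s + 1) * (ψ i * x ((s + 1 : ℕ) - i)) := by
    intro i
    rw [shiftDot, Finset.mul_sum]
    exact Finset.sum_congr rfl fun s _ => by ring
  have hs : ∀ s ∈ Finset.range T,
      Summable fun i : ℕ => vCoord T k (s + 1) * (ψ i * x ((s + 1 : ℕ) - i)) :=
    fun s _ => (h _).mul_left _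
  simp only [e]
  refine ⟨summable_sum hs, ?_⟩
  rw [Summable.tsum_finsetSum hs, pathDot, sum_Icc_one_eq_sum_range
    (fun t : ℕ => filterPath ψ x t * vCoord T k t)]
  refine Finset.sum_congr rfl fun s _ => ?_
  rw [tsum_mul_left, filterPath, mul_comm]

variable {Ω : Type*} [MeasurableSpace Ω] {P : Measure Ω} [IsProbabilityMeasure P]
  {κ b B : ℝ} {η : ℤ → Ω → ℝ} {ψ : ℕ → ℝ}

theorem IsWhiteNoise.ae_summable (h : IsWhiteNoise P κ η) (hψ : Summable fun k => |ψ k|) :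
    ∀ᵐ ω ∂P, ∀ t : ℤ, Summable fun i : ℕ => ψ i * η (t - i) ω := by
  rw [ae_all_iff]
  intro t
  have := (summable_integrable_tsum_of_integral_abs_le
    (F := fun i ω => ψ i * η (t - i) ω) (c := fun i => |ψ i|) (P := P)
    (fun i => (h.integrable _).const_mul _) (fun i => by
      simp only [abs_mul]
      rw [integral_const_mul]
      exact mul_le_of_le_one_right (abs_nonneg _) (h.integral_abs_le _)) hψ).1
  filter_upwards [this] with ω hω
  exact hω.of_abs

theorem IsWhiteNoise.integrable_shiftDot (h : IsWhiteNoise P κ η) (T k : ℕ) (i : ℤ) :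
    Integrable (fun ω => shiftDot T k i fun t => η t ω) P :=
  integrable_finsetSum _ fun _ _ => (h.integrable _).const_mul _

theorem IsWhiteNoise.integral_sq_shiftDot (h : IsWhiteNoise P κ η) {T k : ℕ} (hk : 1 ≤ k)
    (hkT : k < T) (i : ℤ) :
    Integrable (fun ω => (shiftDot T k i fun t => η t ω) ^ 2) P ∧
      ∫ ω, (shiftDot T k i fun t => η t ω) ^ 2 ∂P = 1 := by
  have hinj : Function.Injective fun s : ℕ => ((s + 1 : ℕ) : ℤ) - i := fun a c hac => by
    simpa using hac
  have := h.integral_sq_sum (Finset.range T) (fun s => vCoord T k (s + 1)) hinj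
  refine ⟨this.1, this.2.trans ?_⟩
  have h1 := sum_vCoord_mul_vCoord hk hk hkT hkT
  simpa [sq] using h1

/-- Delaying the path by one step can be moved onto `v_k` by summation by parts, which costs at most
the total variation of `v_k` since `E|η| ≤ 1`; `i` steps cost `i` times as much. -/
theorem IsWhiteNoise.integral_abs_shiftDot_sub_le (h : IsWhiteNoise P κ η) (T k i : ℕ) :
    ∫ ω, |(shiftDot T k i fun t => η t ω) - shiftDot T k 0 fun t => η t ω| ∂P
      ≤ i * vVariation T k := by
  have hI := h.integrable_shiftDot T k
  have step : ∀ i : ℕ, ∫ ω, |(shiftDot T k (i + 1 : ℕ) fun t => η t ω)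
      - shiftDot T k i fun t => η t ω| ∂P ≤ vVariation T k := by
    intro i
    rcases T with _ | N
    · simp [shiftDot, vVariation]
    set w : ℕ → ℝ := fun s => vCoord (N + 1) k (s + 1) with hw
    set y : ℕ → Ω → ℝ := fun s ω => η (s - i) ω with hy
    have e : ∀ ω, (shiftDot (N + 1) k (i + 1 : ℕ) fun t => η t ω)
        - (shiftDot (N + 1) k i fun t => η t ω)
        = y 0 ω * w 0 - y (N + 1) ω * w N
          + ∑ s ∈ Finset.range N, y (s + 1) ω * (w (s + 1) - w s) := by
      intro ω
      rw [← sum_sub_succ_mul (fun s => y s ω) w N, shiftDot, shiftDot, ← Finset.sum_sub_distrib]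
      refine Finset.sum_congr rfl fun s _ => ?_
      have : (((s + 1 : ℕ) : ℤ) - ((i + 1 : ℕ) : ℤ)) = s - i := by push_cast; ring
      rw [this]
      simp only [hw, hy]
      ring
    have hyI : ∀ s, Integrable (y s) P := fun s => h.integrable _
    have hy1 : ∀ s, ∫ ω, |y s ω| ∂P ≤ 1 := fun s => h.integral_abs_le _
    have hle : ∀ ω, |(shiftDot (N + 1) k (i + 1 : ℕ) fun t => η t ω)
        - (shiftDot (N + 1) k i fun t => η t ω)|
        ≤ |y 0 ω| * |w 0| + |y (N + 1) ω| * |w N|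
          + ∑ s ∈ Finset.range N, |y (s + 1) ω| * |w (s + 1) - w s| := by
      intro ω
      rw [e]
      refine (abs_add_le _ _).trans (add_le_add ((abs_sub _ _).trans ?_)
        ((Finset.abs_sum_le_sum_abs _ _).trans ?_))
      · rw [abs_mul, abs_mul]
      · simp only [abs_mul]; exact le_rfl
    have i1 : Integrable (fun ω => |y 0 ω| * |w 0|) P := (hyI _).abs.mul_const _
    have i2 : Integrable (fun ω => |y (N + 1) ω| * |w N|) P := (hyI _).abs.mul_const _
    have i12 : Integrable (fun ω => |y 0 ω| * |w 0| + |y (N + 1) ω| * |w N|) P := i1.add i2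
    have i3 : ∀ s ∈ Finset.range N,
        Integrable (fun ω => |y (s + 1) ω| * |w (s + 1) - w s|) P :=
      fun s _ => (hyI _).abs.mul_const _
    have h1 := integral_mono (((hI (i + 1 : ℕ)).sub (hI i)).abs)
      (i12.add (integrable_finsetSum _ i3)) hle
    refine h1.trans ?_
    simp only [Pi.add_apply]
    rw [integral_add i12 (integrable_finsetSum _ i3), integral_add i1 i2,
      integral_finsetSum _ i3]
    simp only [integral_mul_const]
    refine le_trans ?_ (abs_vCoord_add_variation_le (N := N) (k := k))
    refine add_le_add (add_le_add ?_ ?_) (Finset.sum_le_sum fun s _ => ?_)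
    · exact mul_le_of_le_one_left (abs_nonneg _) (hy1 _)
    · exact mul_le_of_le_one_left (abs_nonneg _) (hy1 _)
    · exact mul_le_of_le_one_left (abs_nonneg _) (hy1 _)
  induction i with
  | zero => simp
  | succ i ih =>
    have hle : ∀ ω, |(shiftDot T k (i + 1 : ℕ) fun t => η t ω) - shiftDot T k 0 fun t => η t ω|
        ≤ |(shiftDot T k (i + 1 : ℕ) fun t => η t ω) - shiftDot T k i fun t => η t ω|
          + |(shiftDot T k i fun t => η t ω) - shiftDot T k 0 fun t => η t ω| :=
      fun ω => abs_sub_le _ _ _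
    have j1 := ((hI (i + 1 : ℕ)).sub (hI i)).abs
    have j2 := ((hI i).sub (hI 0)).abs
    refine (integral_mono ((hI (i + 1 : ℕ)).sub (hI 0)).abs (j1.add j2) hle).trans ?_
    have := integral_add j1 j2
    simp only [Pi.add_apply, Pi.sub_apply] at this ⊢
    rw [this]
    push_cast
    have := step i
    push_cast at this
    linarith

/-- Every delayed product has second moment exactly 1, as `v_k` is a unit vector, so the `L²` norm
is at most `∑ |ψ i|`, uniformly in `k` and `T`. -/
theorem IsWhiteNoise.integral_sq_pathDot_le (h : IsWhiteNoise P κ η) (hψ : IsLag b B ψ)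
    {T k : ℕ} (hk : 1 ≤ k) (hkT : k < T) :
    Integrable (fun ω => (pathDot ψ T k fun t => η t ω) ^ 2) P ∧
      ∫ ω, (pathDot ψ T k fun t => η t ω) ^ 2 ∂P ≤ B ^ 2 := by
  have he : (fun ω => (∑' i : ℕ, ψ i * shiftDot T k i fun t => η t ω) ^ 2)
      =ᵐ[P] fun ω => (pathDot ψ T k fun t => η t ω) ^ 2 := by
    filter_upwards [h.ae_summable hψ.summable_abs] with ω hω
    rw [(pathDot_eq_tsum (x := fun t => η t ω) hω T k).2]
  have h1 := integral_sq_tsum_le (P := P) (a := ψ) (v := 1)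
    (G := fun (i : ℕ) ω => shiftDot T k i fun t => η t ω)
    hψ.summable_abs (fun i => (h.integrable_shiftDot T k i).aestronglyMeasurable.aemeasurable)
    (fun i => (h.integral_sq_shiftDot hk hkT i).1)
    (fun i => (h.integral_sq_shiftDot hk hkT i).2.le)
  refine ⟨h1.1.congr he, ?_⟩
  rw [← integral_congr_ae he]
  refine h1.2.trans ?_
  rw [mul_one]
  exact pow_le_pow_left₀ (tsum_nonneg fun _ => abs_nonneg _) hψ.tsum_abs_le 2

/-- The Beveridge–Nelson approximation: as `v_k` varies slowly, the filter acts on it almost as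
multiplication by `∑ i, ψ i`. The delay `i` contributes `i * |ψ i|`, whence the weight `1 + k` in
`IsLag`. -/
theorem IsWhiteNoise.integral_abs_pathDot_sub_le (h : IsWhiteNoise P κ η) (hψ : IsLag b B ψ)
    (T k : ℕ) :
    Integrable (fun ω => (pathDot ψ T k fun t => η t ω)
      - (∑' i, ψ i) * shiftDot T k 0 fun t => η t ω) P ∧
    ∫ ω, |(pathDot ψ T k fun t => η t ω) - (∑' i, ψ i) * shiftDot T k 0 fun t => η t ω| ∂P
      ≤ B * vVariation T k := by
  have hI := h.integrable_shiftDot T k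
  have hV : 0 ≤ vVariation T k := by
    have := Real.pi_pos
    unfold vVariation; positivity
  have he : (fun ω => ∑' i : ℕ, ψ i * ((shiftDot T k i fun t => η t ω)
      - shiftDot T k 0 fun t => η t ω)) =ᵐ[P] fun ω => (pathDot ψ T k fun t => η t ω)
      - (∑' i, ψ i) * shiftDot T k 0 fun t => η t ω := by
    filter_upwards [h.ae_summable hψ.summable_abs] with ω hω
    obtain ⟨h1, h2⟩ := pathDot_eq_tsum (x := fun t => η t ω) hω T k
    rw [h2, ← tsum_mul_right, ← h1.tsum_sub (hψ.summable_abs.of_abs.mul_right _)]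
    simp only [mul_sub]
  have hd : ∀ i : ℕ, Integrable (fun ω => ψ i * ((shiftDot T k i fun t => η t ω)
      - shiftDot T k 0 fun t => η t ω)) P := fun i => ((hI i).sub (hI 0)).const_mul _
  have hc : ∀ i : ℕ, ∫ ω, |ψ i * ((shiftDot T k i fun t => η t ω)
      - shiftDot T k 0 fun t => η t ω)| ∂P ≤ (i : ℝ) * |ψ i| * vVariation T k := by
    intro i
    simp only [abs_mul]
    rw [integral_const_mul]
    have := mul_le_mul_of_nonneg_left (h.integral_abs_shiftDot_sub_le T k i) (abs_nonneg (ψ i))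
    linarith
  have h1 := integral_abs_tsum_le hd hc (hψ.summable_mul.mul_right _)
  refine ⟨h1.1.congr he, ?_⟩
  have he' := he.mono fun ω hω => congrArg (fun x : ℝ => |x|) hω
  rw [← integral_congr_ae he']
  refine h1.2.trans ?_
  rw [tsum_mul_right]
  exact mul_le_mul_of_nonneg_right hψ.tsum_mul_le hV

end Path

/-! ### Quantitative normal approximation for a single row -/

section Row

variable {Ω : Type*} [MeasurableSpace Ω] {P : Measure Ω} [IsProbabilityMeasure P]

theorem norm_integral_exp_sub_le {X Y : Ω → ℝ} (hX : AEMeasurable X P) (hY : AEMeasurable Y P)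
    (hi : Integrable (fun ω => X ω - Y ω) P) :
    ‖∫ ω, Complex.exp (X ω * Complex.I) ∂P - ∫ ω, Complex.exp (Y ω * Complex.I) ∂P‖
      ≤ ∫ ω, |X ω - Y ω| ∂P := by
  have hE : ∀ {V : Ω → ℝ}, AEMeasurable V P →
      Integrable (fun ω => Complex.exp (V ω * Complex.I)) P := by
    intro V hV
    refine Integrable.of_bound (C := 1) ?_ (ae_of_all _ fun ω => ?_)
    · exact (Complex.continuous_exp.comp
        (Complex.continuous_ofReal.mul continuous_const)).comp_aestronglyMeasurable
        hV.aestronglyMeasurable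
    · rw [Complex.norm_exp_ofReal_mul_I]
  rw [← integral_sub (hE hX) (hE hY)]
  refine norm_integral_le_of_norm_le hi.abs (ae_of_all _ fun ω => ?_)
  have e : Complex.exp (X ω * Complex.I) - Complex.exp (Y ω * Complex.I)
      = Complex.exp (Y ω * Complex.I)
        * (Complex.exp (Complex.I * ((X ω - Y ω : ℝ) : ℂ)) - 1) := by
    rw [mul_sub, ← Complex.exp_add, mul_one]
    congr 2
    push_cast; ring
  rw [e, norm_mul, Complex.norm_exp_ofReal_mul_I, one_mul]
  exact Real.norm_exp_I_mul_ofReal_sub_one_le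

theorem IsWhiteNoise.norm_integral_exp_sum_sub_le {κ : ℝ} {η : ℤ → Ω → ℝ}
    (h : IsWhiteNoise P κ η) (s : Finset ℕ) (c : ℕ → ℝ) {f : ℕ → ℤ}
    (hf : Function.Injective f) {γ : ℝ} (hc : ∀ t ∈ s, |c t| ≤ γ) :
    ‖∫ ω, Complex.exp ((∑ t ∈ s, c t * η (f t) ω : ℝ) * Complex.I) ∂P
        - Complex.exp (-((∑ t ∈ s, c t ^ 2 : ℝ) / 2 : ℂ))‖
      ≤ (4 * γ * (1 + κ) + γ ^ 2 * κ) * ∑ t ∈ s, c t ^ 2 := by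
  have hκ : 0 ≤ κ := (integral_nonneg fun ω => by positivity).trans (h.fourth_moment 0)
  have hi : iIndepFun (fun t ω => c t * η (f t) ω) P :=
    (h.indep.precomp hf).comp (fun t x => c t * x) fun t => by fun_prop
  have h1 := UnitRootCLT.norm_integral_exp_sum_sub_le s hi
    (fun t _ => (h.memLp (f t)).const_mul _) (fun t _ => by
      rw [integral_const_mul, h.mean_zero, mul_zero])
  have e2 : ∀ t, ∫ ω, (c t * η (f t) ω) ^ 2 ∂P = c t ^ 2 := by
    intro t
    simp only [mul_pow]
    rw [integral_const_mul, h.var_one, mul_one]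
  simp only [e2] at h1
  refine h1.trans ?_
  rw [Finset.mul_sum]
  refine Finset.sum_le_sum fun t ht => ?_
  have e3 : ∫ ω, |c t * η (f t) ω| ^ 3 ∂P ≤ |c t| ^ 3 * (1 + κ) := by
    simp only [abs_mul, mul_pow]
    rw [integral_const_mul]
    exact mul_le_mul_of_nonneg_left (h.integral_abs_pow_three_le _) (by positivity)
  have e4 : ∫ ω, (c t * η (f t) ω) ^ 4 ∂P ≤ c t ^ 4 * κ := by
    simp only [mul_pow]
    rw [integral_const_mul]
    exact mul_le_mul_of_nonneg_left (h.fourth_moment _) (by positivity)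
  have hγ := hc t ht
  -- Higher powers of the weights are traded for powers of their maximum `γ`, leaving only `∑ c t ^
  -- 2`.
  have h3 : |c t| ^ 3 * (1 + κ) ≤ γ * c t ^ 2 * (1 + κ) := by
    rw [← sq_abs (c t), pow_succ' |c t| 2]
    gcongr
  have h4 : c t ^ 4 * κ ≤ γ ^ 2 * c t ^ 2 * κ := by
    have : c t ^ 4 = |c t| ^ 2 * c t ^ 2 := by rw [sq_abs]; ring
    rw [this]
    gcongr
  linarith

/-- The weight `π σ_{k+1} / T`, which tends to `1 / (k + 1)`. -/
noncomputable def rowWeight (T k : ℕ) : ℝ := Real.pi / T * sigma T (k + 1)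

theorem rowWeight_nonneg {T k : ℕ} (h : k + 1 < T) : 0 ≤ rowWeight T k := by
  have := sigma_pos (by omega : 1 ≤ k + 1) h
  have := Real.pi_pos
  unfold rowWeight; positivity

theorem rowWeight_le {T k : ℕ} (h : k + 1 < T) : rowWeight T k ≤ Real.pi / (2 * (k + 1 : ℕ)) := by
  have hT : (0 : ℝ) < T := by exact_mod_cast (by omega : 0 < T)
  have h1 := sigma_le (by omega : 1 ≤ k + 1) h
  unfold rowWeight
  refine (mul_le_mul_of_nonneg_left h1 (by have := Real.pi_pos; positivity)).trans (le_of_eq ?_)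
  field_simp

/-- The normalized coordinate `π σ_{k+1} (e v_{k+1}) / (T ∑ᵢ ψᵢ)`. -/
noncomputable def rowCoord (ψ : ℕ → ℝ) (T k : ℕ) (x : ℤ → ℝ) : ℝ :=
  rowWeight T k * (pathDot ψ T (k + 1) x / ∑' i, ψ i)

theorem measurable_rowCoord (ψ : ℕ → ℝ) (T k : ℕ) : Measurable (rowCoord ψ T k) :=
  ((measurable_pathDot ψ T (k + 1)).div_const _).const_mul _

theorem IsWhiteNoise.aemeasurable_rowCoord {Ω : Type*} [MeasurableSpace Ω] {P : Measure Ω}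
    {κ : ℝ} {η : ℤ → Ω → ℝ} (h : IsWhiteNoise P κ η)
    (ψ : ℕ → ℝ) (T k : ℕ) : AEMeasurable (fun ω => rowCoord ψ T k fun t => η t ω) P :=
  ((measurable_rowCoord ψ T k).comp (measurable_pi_iff.2 h.measurable)).aemeasurable

/-- The constant combines `π / 2` from `rowWeight_le`, `B` from the second moment of `pathDot` and
`b` from `|∑ ψ i| ≥ b`. The decay `(k + 1)⁻²` makes the tails of all denominators uniformly small.
-/
theorem IsWhiteNoise.integral_sq_rowCoord_le {κ b B : ℝ} {η : ℤ → Ω → ℝ} {ψ : ℕ → ℝ}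
    (h : IsWhiteNoise P κ η) (hψ : IsLag b B ψ) (hb : 0 < b) {T k : ℕ} (hk : k + 1 < T) :
    Integrable (fun ω => (rowCoord ψ T k fun t => η t ω) ^ 2) P ∧
      ∫ ω, (rowCoord ψ T k fun t => η t ω) ^ 2 ∂P
        ≤ (Real.pi * B / (2 * b)) ^ 2 * (((k + 1 : ℕ) : ℝ) ^ 2)⁻¹ := by
  obtain ⟨h1, h2⟩ := h.integral_sq_pathDot_le hψ (by omega : 1 ≤ k + 1) hk
  have e : ∀ ω, (rowCoord ψ T k fun t => η t ω) ^ 2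
      = (rowWeight T k ^ 2 / (∑' i, ψ i) ^ 2) * (pathDot ψ T (k + 1) fun t => η t ω) ^ 2 := by
    intro ω; rw [rowCoord]; ring
  simp only [e]
  refine ⟨h1.const_mul _, ?_⟩
  rw [integral_const_mul]
  have hp : b ^ 2 ≤ (∑' i, ψ i) ^ 2 := by
    rw [← sq_abs (∑' i, ψ i)]
    exact pow_le_pow_left₀ hb.le hψ.le_abs_tsum 2
  have hw : rowWeight T k ^ 2 ≤ (Real.pi / (2 * (k + 1 : ℕ))) ^ 2 :=
    pow_le_pow_left₀ (rowWeight_nonneg hk) (rowWeight_le hk) 2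
  calc _ ≤ (Real.pi / (2 * (k + 1 : ℕ))) ^ 2 / b ^ 2 * B ^ 2 := by gcongr
    _ = _ := by field_simp

/-- The first error replaces the filtered row by the noise itself, the second is the Lyapunov error.
Neither depends on `ψ` or `η` beyond `b`, `B`, `κ`, which yields uniformity over rows. -/
theorem IsWhiteNoise.norm_integral_exp_rowCoord_sub_le {κ b B : ℝ} {η : ℤ → Ω → ℝ} {ψ : ℕ → ℝ}
    (h : IsWhiteNoise P κ η) (hψ : IsLag b B ψ) (hb : 0 < b) {T m : ℕ} (hm : m < T)
    (u : Fin m → ℝ) :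
    ‖∫ ω, Complex.exp ((∑ k : Fin m, u k * rowCoord ψ T k fun t => η t ω : ℝ) * Complex.I) ∂P
      - Complex.exp (-((∑ k : Fin m, (u k * rowWeight T k) ^ 2 : ℝ) / 2 : ℂ))‖
      ≤ ∑ k : Fin m, |u k * rowWeight T k| * (B * vVariation T (k + 1) / b)
        + (4 * (Real.sqrt (2 / T) * ∑ k : Fin m, |u k * rowWeight T k|) * (1 + κ)
          + (Real.sqrt (2 / T) * ∑ k : Fin m, |u k * rowWeight T k|) ^ 2 * κ)
          * ∑ k : Fin m, (u k * rowWeight T k) ^ 2 := by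
  have hΨ : ∑' i, ψ i ≠ 0 := by
    intro h0
    have := hψ.le_abs_tsum
    rw [h0, abs_zero] at this
    linarith
  -- `c s` is the total coefficient of the noise at time `s + 1`. It is `O(T^{-1/2})`, and
  -- orthonormality of the `v_k` evaluates `∑ c s ^ 2`.
  set c : ℕ → ℝ := fun s => ∑ k : Fin m, u k * rowWeight T k * vCoord T (k + 1) (s + 1) with hc
  have hlin : ∀ ω, ∑ k : Fin m, u k * rowWeight T k * shiftDot T (k + 1) 0 (fun t => η t ω)
      = ∑ s ∈ Finset.range T, c s * η ((s + 1 : ℕ) - 0) ω := by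
    intro ω
    simp only [hc, shiftDot, Finset.mul_sum, Finset.sum_mul]
    rw [Finset.sum_comm]
    exact Finset.sum_congr rfl fun s _ => Finset.sum_congr rfl fun k _ => by ring
  have hcsq : ∑ s ∈ Finset.range T, c s ^ 2 = ∑ k : Fin m, (u k * rowWeight T k) ^ 2 := by
    have e : ∀ s, c s ^ 2 = ∑ k : Fin m, ∑ l : Fin m, (u k * rowWeight T k) * (u l * rowWeight T l)
        * (vCoord T (k + 1) (s + 1) * vCoord T (l + 1) (s + 1)) := by
      intro s
      rw [hc, sq, Finset.sum_mul_sum]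
      exact Finset.sum_congr rfl fun k _ => Finset.sum_congr rfl fun l _ => by ring
    simp only [e]
    rw [Finset.sum_comm]
    refine Finset.sum_congr rfl fun k _ => ?_
    rw [Finset.sum_comm]
    simp only [← Finset.mul_sum]
    have : ∀ l : Fin m, ∑ s ∈ Finset.range T, vCoord T (k + 1) (s + 1) * vCoord T (l + 1) (s + 1)
        = if k = l then 1 else 0 := by
      intro l
      rw [sum_vCoord_mul_vCoord (by omega) (by omega) (by omega) (by omega)]
      simp [Fin.ext_iff]
    simp only [this]
    simp [sq]
  have hcb : ∀ s ∈ Finset.range T, |c s| ≤ Real.sqrt (2 / T) * ∑ k : Fin m, |u k * rowWeight T k| := by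
    intro s _
    rw [Finset.mul_sum]
    refine (Finset.abs_sum_le_sum_abs _ _).trans (Finset.sum_le_sum fun k _ => ?_)
    rw [abs_mul, mul_comm]
    exact mul_le_mul_of_nonneg_right (abs_vCoord_le _ _ _) (abs_nonneg _)
  have hinj : Function.Injective fun s : ℕ => ((s + 1 : ℕ) : ℤ) - 0 := fun a c hac => by
    simpa using hac
  have hB := h.norm_integral_exp_sum_sub_le (Finset.range T) c hinj hcb
  rw [hcsq] at hB
  have hXm : AEMeasurable (fun ω => ∑ k : Fin m, u k * rowCoord ψ T k fun t => η t ω) P :=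
    Finset.aemeasurable_fun_sum _ fun k _ => (h.aemeasurable_rowCoord ψ T k).const_mul _
  have hYm : AEMeasurable (fun ω => ∑ s ∈ Finset.range T, c s * η ((s + 1 : ℕ) - 0) ω) P :=
    Finset.aemeasurable_fun_sum _ fun s _ => ((h.measurable _).const_mul _).aemeasurable
  have hd : ∀ ω, (∑ k : Fin m, u k * rowCoord ψ T k fun t => η t ω)
      - ∑ s ∈ Finset.range T, c s * η ((s + 1 : ℕ) - 0) ω
      = ∑ k : Fin m, u k * rowWeight T k / (∑' i, ψ i) * ((pathDot ψ T (k + 1) fun t => η t ω)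
        - (∑' i, ψ i) * shiftDot T (k + 1) 0 fun t => η t ω) := by
    intro ω
    rw [← hlin, ← Finset.sum_sub_distrib]
    refine Finset.sum_congr rfl fun k _ => ?_
    rw [rowCoord]
    field_simp
  have hR := fun k : Fin m => h.integral_abs_pathDot_sub_le hψ T (k + 1)
  have hRi : ∀ k ∈ (Finset.univ : Finset (Fin m)), Integrable (fun ω =>
      u k * rowWeight T k / (∑' i, ψ i) * ((pathDot ψ T (k + 1) fun t => η t ω)
        - (∑' i, ψ i) * shiftDot T (k + 1) 0 fun t => η t ω)) P :=
    fun k _ => (hR k).1.const_mul _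
  have hdi : Integrable (fun ω => (∑ k : Fin m, u k * rowCoord ψ T k fun t => η t ω)
      - ∑ s ∈ Finset.range T, c s * η ((s + 1 : ℕ) - 0) ω) P := by
    simp only [hd]
    exact integrable_finsetSum _ hRi
  have hA := norm_integral_exp_sub_le hXm hYm hdi
  have hA2 : ∫ ω, |(∑ k : Fin m, u k * rowCoord ψ T k fun t => η t ω)
      - ∑ s ∈ Finset.range T, c s * η ((s + 1 : ℕ) - 0) ω| ∂P
      ≤ ∑ k : Fin m, |u k * rowWeight T k| * (B * vVariation T (k + 1) / b) := by
    simp only [hd]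
    refine (integral_mono (integrable_finsetSum _ hRi).abs
      (integrable_finsetSum _ fun k hk => (hRi k hk).abs)
      fun ω => Finset.abs_sum_le_sum_abs _ _).trans ?_
    rw [integral_finsetSum _ fun k hk => (hRi k hk).abs]
    refine Finset.sum_le_sum fun k _ => ?_
    simp only [abs_mul (u k * rowWeight T k / ∑' i, ψ i)]
    rw [integral_const_mul, abs_div, div_mul_eq_mul_div, mul_div_assoc]
    refine mul_le_mul_of_nonneg_left ?_ (abs_nonneg _)
    have h0 : 0 ≤ ∫ ω, |(pathDot ψ T (k + 1) fun t => η t ω)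
        - (∑' i, ψ i) * shiftDot T (k + 1) 0 fun t => η t ω| ∂P :=
      integral_nonneg fun ω => abs_nonneg _
    exact div_le_div₀ (h0.trans (hR k).2) (hR k).2 hb hψ.le_abs_tsum
  refine (norm_sub_le_norm_sub_add_norm_sub _ _ _).trans (add_le_add (hA.trans hA2) hB)

end Row

/-! ### Convergence of the row functionals -/

section Limit

variable {Ω : Type*} [MeasurableSpace Ω] {P : Measure Ω}
  {Ω' : Type*} [MeasurableSpace Ω'] {P' : Measure Ω'}

theorem summable_inv_succ_sq : Summable fun k : ℕ => (((k + 1 : ℕ) : ℝ) ^ 2)⁻¹ :=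
  (summable_nat_add_iff 1).2 (Real.summable_nat_pow_inv.2 one_lt_two)

theorem tendsto_rowWeight (k : ℕ) :
    Tendsto (fun T => rowWeight T k) atTop (𝓝 (1 / (k + 1 : ℕ))) :=
  tendsto_pi_div_mul_sigma (by omega : 1 ≤ k + 1)

theorem tendsto_integral_exp_rowCoord [IsProbabilityMeasure P] {I : Type*} {l : Filter I} {κ b B : ℝ}
    {η : I → ℤ → Ω → ℝ} {ψ : I → ℕ → ℝ} {T : I → ℕ} (hη : ∀ i, IsWhiteNoise P κ (η i))
    (hψ : ∀ i, IsLag b B (ψ i)) (hb : 0 < b) (hT : Tendsto T l atTop) {m : ℕ} (u : Fin m → ℝ) :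
    Tendsto (fun i => ∫ ω, Complex.exp
      ((∑ k : Fin m, u k * rowCoord (ψ i) (T i) k fun t => η i t ω : ℝ) * Complex.I) ∂P) l
      (𝓝 (Complex.exp (-((∑ k : Fin m, (u k * (1 / ((k : ℕ) + 1 : ℕ))) ^ 2 : ℝ) / 2 : ℂ)))) := by
  have hw : ∀ k : Fin m, Tendsto (fun T => u k * rowWeight T k) atTop
      (𝓝 (u k * (1 / ((k : ℕ) + 1 : ℕ)))) := fun k => (tendsto_rowWeight k).const_mul _
  have hsq : Tendsto (fun T => ∑ k : Fin m, (u k * rowWeight T k) ^ 2) atTop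
      (𝓝 (∑ k : Fin m, (u k * (1 / ((k : ℕ) + 1 : ℕ))) ^ 2)) :=
    tendsto_finsetSum _ fun k _ => (hw k).pow 2
  have habs : Tendsto (fun T => ∑ k : Fin m, |u k * rowWeight T k|) atTop
      (𝓝 (∑ k : Fin m, |u k * (1 / ((k : ℕ) + 1 : ℕ))|)) :=
    tendsto_finsetSum _ fun k _ => (hw k).abs
  have hsqrt : Tendsto (fun T : ℕ => Real.sqrt (2 / T)) atTop (𝓝 0) := by
    have := (Real.continuous_sqrt.tendsto 0).comp (tendsto_const_div_atTop_nhds_zero_nat 2)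
    rwa [Real.sqrt_zero] at this
  have h1 : Tendsto (fun T => ∑ k : Fin m, |u k * rowWeight T k|
      * (B * vVariation T (k + 1) / b)) atTop (𝓝 0) := by
    have : Tendsto (fun T => ∑ k : Fin m, |u k * rowWeight T k|
        * (B * vVariation T (k + 1) / b)) atTop
        (𝓝 (∑ k : Fin m, |u k * (1 / ((k : ℕ) + 1 : ℕ))| * (B * 0 / b))) :=
      tendsto_finsetSum _ fun k _ => (hw k).abs.mul
        (((tendsto_vVariation (k + 1)).const_mul B).div_const b)
    simpa using this
  have h2 : Tendsto (fun T : ℕ => (4 * (Real.sqrt (2 / T) * ∑ k : Fin m, |u k * rowWeight T k|)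
        * (1 + κ) + (Real.sqrt (2 / T) * ∑ k : Fin m, |u k * rowWeight T k|) ^ 2 * κ)
          * ∑ k : Fin m, (u k * rowWeight T k) ^ 2) atTop (𝓝 0) := by
    have h3 := hsqrt.mul habs
    rw [zero_mul] at h3
    have := (((h3.const_mul 4).mul_const (1 + κ)).add ((h3.pow 2).mul_const κ)).mul hsq
    simpa using this
  have h3 : Tendsto (fun T => Complex.exp (-((∑ k : Fin m, (u k * rowWeight T k) ^ 2 : ℝ) / 2 : ℂ)))
      atTop (𝓝 (Complex.exp
        (-((∑ k : Fin m, (u k * (1 / ((k : ℕ) + 1 : ℕ))) ^ 2 : ℝ) / 2 : ℂ)))) :=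
    (Complex.continuous_exp.tendsto _).comp
      (((Complex.continuous_ofReal.tendsto _).comp hsq).div_const 2).neg
  have h12 := (h1.add h2).comp hT
  rw [add_zero] at h12
  have hd := squeeze_zero_norm' (f := fun i => ∫ ω, Complex.exp
      ((∑ k : Fin m, u k * rowCoord (ψ i) (T i) k fun t => η i t ω : ℝ) * Complex.I) ∂P
      - Complex.exp (-((∑ k : Fin m, (u k * rowWeight (T i) k) ^ 2 : ℝ) / 2 : ℂ))) (by
    filter_upwards [hT.eventually_gt_atTop m] with i hi
    exact (hη i).norm_integral_exp_rowCoord_sub_le (hψ i) hb hi u) h12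
  have := hd.add (h3.comp hT)
  simpa using this

/-- The tail bound common to the prelimit and limit denominators. -/
noncomputable def tailBound (C : ℝ) (m : ℕ) : ℝ := ∑' k : ℕ, C * (((k + m + 1 : ℕ) : ℝ) ^ 2)⁻¹

theorem tendsto_tailBound (C : ℝ) : Tendsto (tailBound C) atTop (𝓝 0) :=
  tendsto_sum_nat_add fun k : ℕ => C * (((k + 1 : ℕ) : ℝ) ^ 2)⁻¹

theorem summable_tail (C : ℝ) (m : ℕ) :
    Summable fun k : ℕ => C * (((k + m + 1 : ℕ) : ℝ) ^ 2)⁻¹ :=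
  (summable_nat_add_iff (f := fun k : ℕ => C * (((k + 1 : ℕ) : ℝ) ^ 2)⁻¹) m).2
    (summable_inv_succ_sq.mul_left C)

theorem tail_finite_le {b : ℕ → Ω → ℝ} {C C' : ℝ} {N m : ℕ} (hC : 0 ≤ C') (hCC : C ≤ C')
    (hmN : m ≤ N)
    (hb : ∀ k < N, Integrable (fun ω => b k ω ^ 2) P ∧
      ∫ ω, b k ω ^ 2 ∂P ≤ C * (((k + 1 : ℕ) : ℝ) ^ 2)⁻¹) :
    (∀ ω, ∑ t ∈ Finset.range m, b t ω ^ 2 ≤ ∑ t ∈ Finset.range N, b t ω ^ 2) ∧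
      Integrable (fun ω => ∑ t ∈ Finset.range N, b t ω ^ 2 - ∑ t ∈ Finset.range m, b t ω ^ 2) P ∧
      ∫ ω, (∑ t ∈ Finset.range N, b t ω ^ 2 - ∑ t ∈ Finset.range m, b t ω ^ 2) ∂P
        ≤ tailBound C' m := by
  have e : ∀ ω, ∑ t ∈ Finset.range N, b t ω ^ 2 - ∑ t ∈ Finset.range m, b t ω ^ 2
      = ∑ k ∈ Finset.range (N - m), b (k + m) ω ^ 2 := by
    intro ω
    rw [← Finset.sum_range_add_sum_Ico (fun t => b t ω ^ 2) hmN, add_sub_cancel_left,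
      Finset.sum_Ico_eq_sum_range]
    exact Finset.sum_congr rfl fun k _ => by rw [add_comm]
  have hlt : ∀ k ∈ Finset.range (N - m), k + m < N := fun k hk => by
    have := Finset.mem_range.1 hk; omega
  have hi : ∀ k ∈ Finset.range (N - m), Integrable (fun ω => b (k + m) ω ^ 2) P :=
    fun k hk => (hb _ (hlt k hk)).1
  refine ⟨fun ω => ?_, ?_, ?_⟩
  · exact Finset.sum_le_sum_of_subset_of_nonneg (Finset.range_mono hmN) fun _ _ _ => sq_nonneg _
  · simp only [e]
    exact integrable_finsetSum _ hi
  · simp only [e]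
    rw [integral_finsetSum _ hi]
    refine (Finset.sum_le_sum fun k hk => (hb _ (hlt k hk)).2.trans ?_).trans
      ((summable_tail C' m).sum_le_tsum _ fun k _ => by positivity)
    exact mul_le_mul_of_nonneg_right hCC (by positivity)

theorem tail_series_le {b : ℕ → Ω → ℝ} {C : ℝ} (hb : ∀ k, Integrable (fun ω => b k ω ^ 2) P ∧
      ∫ ω, b k ω ^ 2 ∂P ≤ C * (((k + 1 : ℕ) : ℝ) ^ 2)⁻¹) (m : ℕ) :
    (∀ᵐ ω ∂P, ∑ t ∈ Finset.range m, b t ω ^ 2 ≤ ∑' t, b t ω ^ 2) ∧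
      Integrable (fun ω => ∑' t, b t ω ^ 2 - ∑ t ∈ Finset.range m, b t ω ^ 2) P ∧
      ∫ ω, (∑' t, b t ω ^ 2 - ∑ t ∈ Finset.range m, b t ω ^ 2) ∂P ≤ tailBound C m := by
  have e : ∀ k ω, |b k ω ^ 2| = b k ω ^ 2 := fun k ω => abs_of_nonneg (sq_nonneg _)
  obtain ⟨h1, -, -⟩ := summable_integrable_tsum_of_integral_abs_le (F := fun k ω => b k ω ^ 2)
    (fun k => (hb k).1) (fun k => by simp only [e]; exact (hb k).2)
    (summable_inv_succ_sq.mul_left C)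
  obtain ⟨-, h2, h3⟩ := summable_integrable_tsum_of_integral_abs_le
    (F := fun k ω => b (k + m) ω ^ 2)
    (fun k => (hb _).1) (fun k => by simp only [e]; exact (hb _).2) (summable_tail C m)
  simp only [e] at h1 h2 h3
  have he : (fun ω => ∑' k, b (k + m) ω ^ 2)
      =ᵐ[P] fun ω => ∑' t, b t ω ^ 2 - ∑ t ∈ Finset.range m, b t ω ^ 2 := by
    filter_upwards [h1] with ω hω
    have := hω.sum_add_tsum_nat_add m
    linarith
  refine ⟨?_, h2.congr he, ?_⟩
  · filter_upwards [h1] with ω hω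
    exact hω.sum_le_tsum _ fun _ _ => sq_nonneg _
  · rw [← integral_congr_ae he]
    exact h3

/-- Uniform convergence, over rows, of expectations of the self-normalized quadratic forms. -/
theorem tendsto_integral_rowCoord [IsProbabilityMeasure P] [IsProbabilityMeasure P'] {I : Type*} {l : Filter I} [l.IsCountablyGenerated]
    {κ b B : ℝ} {η : I → ℤ → Ω → ℝ} {ψ : I → ℕ → ℝ} {T : I → ℕ}
    (hη : ∀ i, IsWhiteNoise P κ (η i)) (hψ : ∀ i, IsLag b B (ψ i)) (hb : 0 < b)
    (hT : Tendsto T l atTop) {Z : ℕ → Ω' → ℝ} (hZi : iIndepFun Z P')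
    (hZ : ∀ t, HasLaw (Z t) (gaussianReal 0 1) P') {K : ℕ} (s : Fin K × Fin K → ℝ)
    {L : ℝ} {G : ℝ → ℝ} (hL : 0 ≤ L) (hGc : Continuous G)
    (hG : ∀ x y, |x| ≤ ∑ p, |s p| → |y| ≤ ∑ p, |s p| → |G x - G y| ≤ L * |x - y|) :
    Tendsto (fun i => ∫ ω, G (quadRatio s (fun k => rowCoord (ψ i) (T i) k fun t => η i t ω)
        (∑ k ∈ Finset.range (T i - 1), (rowCoord (ψ i) (T i) k fun t => η i t ω) ^ 2)) ∂P) l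
      (𝓝 (∫ ω, G (quadRatio s (fun k => 1 / (k + 1 : ℕ) * Z k ω)
        (∑' k : ℕ, (1 / (k + 1 : ℕ) * Z k ω) ^ 2)) ∂P')) := by
  have hm : ∀ i k, AEMeasurable (fun ω => rowCoord (ψ i) (T i) k fun t => η i t ω) P :=
    fun i k => (hη i).aemeasurable_rowCoord (ψ i) (T i) k
  have hm' : ∀ k : ℕ, AEMeasurable (fun ω => 1 / (k + 1 : ℕ) * Z k ω) P' :=
    fun k => (hZ k).aemeasurable.const_mul _
  set C : ℝ := (Real.pi * B / (2 * b)) ^ 2 with hCdef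
  have hC : 0 ≤ C := sq_nonneg _
  have hZ2 : ∀ k, Integrable (fun ω => Z k ω ^ 2) P' ∧ ∫ ω, Z k ω ^ 2 ∂P' = 1 := by
    intro k
    have hlp : MemLp (Z k) 2 P' := by
      have h1 : MemLp id 2 (P'.map (Z k)) := by
        rw [(hZ k).map_eq]; exact memLp_id_gaussianReal 2
      exact h1.comp_of_map (hZ k).aemeasurable
    have hv := (hZ k).variance_eq
    have hμ := (hZ k).integral_eq
    rw [variance_id_gaussianReal, variance_eq_sub hlp, hμ, integral_id_gaussianReal] at hv
    exact ⟨hlp.integrable_sq, by simpa using hv⟩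
  have hlim : ∀ k : ℕ, Integrable (fun ω => (1 / (k + 1 : ℕ) * Z k ω) ^ 2) P' ∧
      ∫ ω, (1 / (k + 1 : ℕ) * Z k ω) ^ 2 ∂P' ≤ (C + 1) * (((k + 1 : ℕ) : ℝ) ^ 2)⁻¹ := by
    intro k
    simp only [mul_pow]
    refine ⟨(hZ2 k).1.const_mul _, ?_⟩
    rw [integral_const_mul, (hZ2 k).2, mul_one, div_pow, one_pow, one_div]
    exact le_mul_of_one_le_left (by positivity) (by linarith)
  -- The prelimit tail has constant `C`, the Gaussian tail constant 1; `C + 1` dominates both.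
  refine tendsto_integral_quadRatio s (b' := fun k ω => 1 / (k + 1 : ℕ) * Z k ω)
    (S' := fun ω => ∑' k : ℕ, (1 / (k + 1 : ℕ) * Z k ω) ^ 2) (ρ := tailBound (C + 1))
    hm (fun i => Finset.aemeasurable_fun_sum _ fun k _ => (hm i k).pow_const 2) hm'
    (AEMeasurable.tsum fun k => (hm' k).pow_const 2) hL hGc hG (tendsto_tailBound _)
    (fun m => ?_) (fun m => tail_series_le hlim m) (fun m f => ?_) ?_
  · filter_upwards [hT.eventually_gt_atTop m] with i hi
    have := tail_finite_le (P := P) (b := fun k ω => rowCoord (ψ i) (T i) k fun t => η i t ω)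
      (C := C) (C' := C + 1) (N := T i - 1) (m := m) (by linarith) (by linarith) (by omega)
      fun k hk => (hη i).integral_sq_rowCoord_le (hψ i) hb (by omega)
    exact ⟨ae_of_all _ this.1, this.2⟩
  · refine tendsto_integral_of_tendsto_integral_exp m hm hm' (fun u => ?_) f
    have h1 := tendsto_integral_exp_rowCoord hη hψ hb hT u
    have h2 := integral_exp_sum_mul_gaussian (P' := P') (Finset.univ : Finset (Fin m))
      (hZi.precomp Fin.val_injective) (fun t : Fin m => hZ t)
      (fun k => u k * (1 / ((k : ℕ) + 1 : ℕ)))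
    rw [← h2] at h1
    simp only [mul_assoc] at h1 ⊢
    exact h1
  · have h1 : ∀ᵐ x ∂(P'.map (Z 0)), x ≠ 0 := by
      rw [(hZ 0).map_eq]
      have := nullSingletonClass_gaussianReal (μ := 0) (v := 1) one_ne_zero
      exact Measure.ae_ne _ _
    filter_upwards [ae_of_ae_map (hZ 0).aemeasurable h1] with ω hω
    simpa using hω

end Limit

/-! ### From the model to row functionals; limit covariance; the CLT for bounded rows -/

section Assembly

variable {Ω : Type*} [MeasurableSpace Ω] {P : Measure Ω}
  {Ω' : Type*} [MeasurableSpace Ω'] {P' : Measure Ω'}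

theorem NoiseAssumption.exists_isWhiteNoise {ε : ℕ → ℤ → Ω → ℝ}
    (h : NoiseAssumption P ε) : ∃ κ : ℝ, ∀ i, IsWhiteNoise P κ (ε i) := by
  obtain ⟨κ, hκ⟩ := h.fourth_moment
  refine ⟨κ, fun i => ⟨h.measurable i, ?_, fun t => (h.mean_zero i t).2, h.var_one i, fun t => ?_,
    fun t => (hκ i t).2⟩⟩
  · exact h.indep.precomp (g := fun t : ℤ => (i, t)) fun a b hab => by simpa using hab
  · rw [← integrable_norm_rpow_iff (h.measurable i t).aestronglyMeasurable (by norm_num)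
      (by norm_num)]
    refine (hκ i t).1.congr (ae_of_all _ fun ω => ?_)
    simp only [ENNReal.toReal_ofNat]
    rw [Real.norm_eq_abs, ← Even.pow_abs (show Even 4 by decide) (ε i t ω)]
    exact_mod_cast (Real.rpow_natCast |ε i t ω| 4).symm

/-- The series for `e_t` is taken in `ℝⁿ` and has the default value 0 unless it converges there, so
summability is needed in every row before one row can be read off. -/
theorem linearProcess_eq_filterPath {Ω : Type*} {ε : ℕ → ℤ → Ω → ℝ} {n : ℕ}
    {Ψ : ℕ → Matrix (Fin n) (Fin n) ℝ} (hd : ∀ k, (Ψ k).IsDiag) {ω : Ω}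
    (hs : ∀ (j : Fin n) (t : ℤ), Summable fun i : ℕ => Ψ i j j * ε j (t - i) ω) (t : ℤ)
    (j : Fin n) :
    linearProcess ε Ψ t ω j = filterPath (fun i => Ψ i j j) (fun t => ε j t ω) t := by
  have e : ∀ (k : ℕ) (j : Fin n), (Ψ k *ᵥ fun i : Fin n => ε (i : ℕ) (t - (k : ℤ)) ω) j
      = Ψ k j j * ε j (t - k) ω := by
    intro k j
    rw [Matrix.mulVec, dotProduct]
    refine Finset.sum_eq_single j (fun i _ hij => ?_) fun h => absurd (Finset.mem_univ j) h
    rw [hd k hij.symm, zero_mul]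
  have hsum : Summable fun k : ℕ => Ψ k *ᵥ fun i : Fin n => ε (i : ℕ) (t - (k : ℤ)) ω := by
    rw [Pi.summable]
    intro j
    simp only [e]
    exact hs j t
  rw [linearProcess, tsum_apply hsum, filterPath]
  simp only [e]

/-- The linear combination `∑ s_{kl} M_{kl}` of one row, as a function of the noise path. -/
noncomputable def rowQuad {K : ℕ} (s : Fin K × Fin K → ℝ) (ψ : ℕ → ℝ) (T : ℕ) (x : ℤ → ℝ) : ℝ :=
  quadRatio s (fun k => rowCoord ψ T k x) (∑ k ∈ Finset.range (T - 1), rowCoord ψ T k x ^ 2)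

theorem measurable_rowQuad {K : ℕ} (s : Fin K × Fin K → ℝ) (ψ : ℕ → ℝ) (T : ℕ) :
    Measurable (rowQuad s ψ T) := by
  unfold rowQuad quadRatio
  exact Finset.measurable_fun_sum _ fun p _ => (((measurable_rowCoord _ _ _).mul
    (measurable_rowCoord _ _ _)).div (Finset.measurable_fun_sum _ fun k _ =>
    (measurable_rowCoord _ _ _).pow_const 2)).const_mul _

theorem abs_rowQuad_le {K : ℕ} (s : Fin K × Fin K → ℝ) (ψ : ℕ → ℝ) {T : ℕ} (hT : K < T)
    (x : ℤ → ℝ) : |rowQuad s ψ T x| ≤ ∑ p, |s p| :=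
  abs_quadRatio_le (m := T - 1) s (by omega) le_rfl

/-- The ratio is homogeneous of degree 0, so the common factor `π / (T ∑ ψ)` cancels. -/
theorem M_eq_rowCoord {Ω : Type*} {ε : ℕ → ℤ → Ω → ℝ} {n : ℕ} {Ψ : ℕ → Matrix (Fin n) (Fin n) ℝ} {ω : Ω}
    (T : ℕ) (j : Fin n) (hΨ : ∑' i, Ψ i j j ≠ 0)
    (he : ∀ t : ℤ, linearProcess ε Ψ t ω j = filterPath (fun i => Ψ i j j) (fun t => ε j t ω) t)
    (k l : ℕ) :
    M ε Ψ T j (k + 1) (l + 1) ω = rowCoord (fun i => Ψ i j j) T k (fun t => ε j t ω)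
      * rowCoord (fun i => Ψ i j j) T l (fun t => ε j t ω)
      / ∑ k ∈ Finset.range (T - 1), rowCoord (fun i => Ψ i j j) T k (fun t => ε j t ω) ^ 2 := by
  rcases Nat.eq_zero_or_pos T with rfl | hT
  · simp [M, sigma, rowCoord, rowWeight]
  have hT' : (T : ℝ) ≠ 0 := by exact_mod_cast hT.ne'
  set α : ℝ := Real.pi / T / ∑' i, Ψ i j j with hα
  have hα0 : α ≠ 0 := div_ne_zero (div_ne_zero Real.pi_ne_zero hT') hΨ
  have hr : ∀ k, rowDot ε Ψ T j k ω = pathDot (fun i => Ψ i j j) T k fun t => ε j t ω := by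
    intro k
    unfold rowDot pathDot
    exact Finset.sum_congr rfl fun t _ => by rw [he]
  have hc : ∀ k, rowCoord (fun i => Ψ i j j) T k (fun t => ε j t ω)
      = α * (sigma T (k + 1) * rowDot ε Ψ T j (k + 1) ω) := by
    intro k
    rw [rowCoord, rowWeight, hr, hα]
    ring
  have hS : ∑ t ∈ Finset.Ico 1 T, sigma T t ^ 2 * rowDot ε Ψ T j t ω ^ 2
      = ∑ k ∈ Finset.range (T - 1), (sigma T (k + 1) * rowDot ε Ψ T j (k + 1) ω) ^ 2 := by
    rw [Finset.sum_Ico_eq_sum_range]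
    exact Finset.sum_congr rfl fun k _ => by rw [add_comm 1 k]; ring
  simp only [hc]
  rw [M, hS]
  simp only [mul_pow α]
  rw [← Finset.mul_sum]
  have : α * (sigma T (k + 1) * rowDot ε Ψ T j (k + 1) ω)
      * (α * (sigma T (l + 1) * rowDot ε Ψ T j (l + 1) ω))
      = α ^ 2 * (sigma T (k + 1) * sigma T (l + 1) * rowDot ε Ψ T j (k + 1) ω
        * rowDot ε Ψ T j (l + 1) ω) := by ring
  rw [this, mul_div_mul_left _ _ (pow_ne_zero 2 hα0)]

theorem limitM_eq {Ω' : Type*} {Z : ℕ+ → Ω' → ℝ} (k l : ℕ) (ω : Ω') :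
    limitM Z k.succPNat l.succPNat ω = 1 / (k + 1 : ℕ) * Z k.succPNat ω
      * (1 / (l + 1 : ℕ) * Z l.succPNat ω)
      / ∑' k : ℕ, (1 / (k + 1 : ℕ) * Z k.succPNat ω) ^ 2 := by
  have h : ∑' t : ℕ+, ((t : ℝ) ^ 2)⁻¹ * Z t ω ^ 2
      = ∑' k : ℕ, (1 / (k + 1 : ℕ) * Z k.succPNat ω) ^ 2 := by
    rw [← Equiv.pnatEquivNat.symm.tsum_eq]
    refine tsum_congr fun k => ?_
    rw [mul_pow, one_div, inv_pow]
    rfl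
  rw [limitM, h]
  congr 1
  simp only [Nat.succPNat_coe, Nat.succ_eq_add_one]
  rw [mul_inv, one_div, one_div]
  ring

theorem abs_limitM_le_one {Ω' : Type*} (Z : ℕ+ → Ω' → ℝ) (k l : ℕ) (ω : Ω') :
    |limitM Z k.succPNat l.succPNat ω| ≤ 1 := by
  rw [limitM_eq]
  by_cases hs : Summable fun k : ℕ => (1 / (k + 1 : ℕ) * Z k.succPNat ω) ^ 2
  · exact abs_mul_div_le_one (b := fun k : ℕ => 1 / (k + 1 : ℕ) * Z k.succPNat ω)
      (m := max k l + 1) (by omega) (by omega)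
      (hs.sum_le_tsum _ fun _ _ => sq_nonneg _)
  -- A divergent denominator reads as 0, and so does the quotient.
  · rw [tsum_eq_zero_of_not_summable hs]; simp

theorem memLp_limitM [IsProbabilityMeasure P'] {Z : ℕ+ → Ω' → ℝ}
    (hZ : ∀ t, AEMeasurable (Z t) P') (k l : ℕ) :
    MemLp (limitM Z k.succPNat l.succPNat) 2 P' := by
  refine MemLp.of_bound (C := 1) (AEMeasurable.aestronglyMeasurable ?_)
    (ae_of_all _ fun ω => abs_limitM_le_one Z k l ω)
  unfold limitM
  exact (((hZ _).const_mul _).mul (hZ _)).div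
    (AEMeasurable.tsum fun t => ((hZ t).pow_const 2).const_mul _)

/-- Bilinearity of the covariance. This identifies the variance that Cramér–Wold calls for, and
gives positive semidefiniteness. -/
theorem dotProduct_limitCov_mulVec [IsProbabilityMeasure P'] {Z : ℕ+ → Ω' → ℝ}
    (hZ : ∀ t, AEMeasurable (Z t) P') {K : ℕ} (s : Fin K × Fin K → ℝ) :
    s ⬝ᵥ limitCov P' Z K *ᵥ s
      = Var[fun ω => ∑ p, s p * limitM Z (p.1 : ℕ).succPNat (p.2 : ℕ).succPNat ω; P'] := by
  have hm : ∀ p : Fin K × Fin K,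
      MemLp (fun ω => s p * limitM Z (p.1 : ℕ).succPNat (p.2 : ℕ).succPNat ω) 2 P' :=
    fun p => (memLp_limitM hZ _ _).const_mul _
  rw [variance_fun_sum' (s := Finset.univ) fun p _ => hm p, dotProduct]
  refine Finset.sum_congr rfl fun p _ => ?_
  rw [Matrix.mulVec, dotProduct, Finset.mul_sum]
  refine Finset.sum_congr rfl fun q _ => ?_
  rw [covariance_const_mul_left, covariance_const_mul_right]
  simp only [limitCov, Matrix.of_apply]
  ring

theorem posSemidef_limitCov [IsProbabilityMeasure P'] {Z : ℕ+ → Ω' → ℝ}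
    (hZ : ∀ t, AEMeasurable (Z t) P') (K : ℕ) : (limitCov P' Z K).PosSemidef := by
  refine Matrix.PosSemidef.of_dotProduct_mulVec_nonneg ?_ fun s => ?_
  · ext p q
    simp only [limitCov, Matrix.conjTranspose_apply, Matrix.of_apply, star_trivial]
    exact covariance_comm _ _
  · rw [star_trivial, dotProduct_limitCov_mulVec hZ]
    exact variance_nonneg _ _

/-- Convergence along `comap Sigma.fst atTop` is uniform in `j`, so averages over `j` converge to
the same limit. -/
theorem tendsto_average {f : (Σ n : ℕ, Fin n) → ℝ} {V : ℝ}
    (h : Tendsto f (comap Sigma.fst atTop) (𝓝 V)) :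
    Tendsto (fun n : ℕ => ∑ j : Fin n, (n : ℝ)⁻¹ * f ⟨n, j⟩) atTop (𝓝 V) := by
  rw [Metric.tendsto_nhds] at h ⊢
  intro e he
  have h1 := eventually_comap.1 (h (e / 2) (by positivity))
  filter_upwards [h1, eventually_gt_atTop 0] with n hn hn0
  have hn0' : (0 : ℝ) < n := by exact_mod_cast hn0
  have e1 : ∑ j : Fin n, (n : ℝ)⁻¹ * f ⟨n, j⟩ - V = ∑ j : Fin n, (n : ℝ)⁻¹ * (f ⟨n, j⟩ - V) := by
    simp only [mul_sub, Finset.sum_sub_distrib]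
    simp [hn0'.ne']
  rw [Real.dist_eq, e1]
  refine lt_of_le_of_lt (Finset.abs_sum_le_sum_abs _ _) ?_
  have : ∀ j : Fin n, |(n : ℝ)⁻¹ * (f ⟨n, j⟩ - V)| ≤ (n : ℝ)⁻¹ * (e / 2) := by
    intro j
    rw [abs_mul, abs_of_pos (inv_pos.2 hn0')]
    have := (hn ⟨n, j⟩ rfl).le
    rw [Real.dist_eq] at this
    gcongr
  refine lt_of_le_of_lt (Finset.sum_le_sum fun j _ => this j) ?_
  simp only [Finset.sum_const, Finset.card_univ, Fintype.card_fin, nsmul_eq_mul]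
  rw [← mul_assoc, mul_inv_cancel₀ hn0'.ne']
  linarith

/-- A bound on the distance to the Gaussian characteristic function for normalized sums of bounded
independent variables. -/
theorem norm_integral_exp_normalized_sum_sub_le [IsProbabilityMeasure P] {n : ℕ} (hn : 0 < n)
    {Y : Fin n → Ω → ℝ} (hY : iIndepFun Y P) (hm : ∀ j, AEMeasurable (Y j) P) {A : ℝ}
    (hA : ∀ j ω, |Y j ω| ≤ A) :
    ‖∫ ω, Complex.exp ((∑ j, (Real.sqrt n)⁻¹ * (Y j ω - ∫ ω', Y j ω' ∂P) : ℝ) * Complex.I) ∂P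
      - Complex.exp (-((∑ j, (n : ℝ)⁻¹ * (∫ ω, Y j ω ^ 2 ∂P - (∫ ω, Y j ω ∂P) ^ 2) : ℝ) / 2 : ℂ))‖
      ≤ 4 * (2 * A) ^ 3 * (Real.sqrt n)⁻¹ + (2 * A) ^ 4 * (n : ℝ)⁻¹ := by
  have hn' : (0 : ℝ) < n := by exact_mod_cast hn
  set r : ℝ := (Real.sqrt n)⁻¹ with hr
  have hr0 : 0 ≤ r := by positivity
  have hr2 : r ^ 2 = (n : ℝ)⁻¹ := by rw [hr, inv_pow, Real.sq_sqrt hn'.le]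
  have hlpY : ∀ j, MemLp (Y j) 2 P := fun j =>
    MemLp.of_bound (hm j).aestronglyMeasurable A (ae_of_all _ fun ω => hA j ω)
  have hEA : ∀ j, |∫ ω, Y j ω ∂P| ≤ A := by
    intro j
    have := norm_integral_le_of_norm_le_const (μ := P) (f := Y j) (C := A)
      (ae_of_all _ fun ω => hA j ω)
    simpa using this
  have hbd : ∀ j ω, |r * (Y j ω - ∫ ω', Y j ω' ∂P)| ≤ r * (2 * A) := by
    intro j ω
    rw [abs_mul, abs_of_nonneg hr0]
    refine mul_le_mul_of_nonneg_left ((abs_sub _ _).trans ?_) hr0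
    linarith [hA j ω, hEA j]
  have hXm : ∀ j, AEMeasurable (fun ω => r * (Y j ω - ∫ ω', Y j ω' ∂P)) P := fun j =>
    ((hm j).sub_const _).const_mul _
  have hi : iIndepFun (fun j ω => r * (Y j ω - ∫ ω', Y j ω' ∂P)) P :=
    hY.comp (fun j x => r * (x - ∫ ω', Y j ω' ∂P)) fun j => by fun_prop
  have h1 := norm_integral_exp_sum_sub_le (Finset.univ : Finset (Fin n)) hi
    (fun j _ => MemLp.of_bound (hXm j).aestronglyMeasurable _ (ae_of_all _ fun ω => hbd j ω))
    (fun j _ => by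
      rw [integral_const_mul, integral_sub ((hlpY j).integrable (by norm_num))
        (integrable_const _)]
      simp)
  have e2 : ∀ j, ∫ ω, (r * (Y j ω - ∫ ω', Y j ω' ∂P)) ^ 2 ∂P
      = (n : ℝ)⁻¹ * (∫ ω, Y j ω ^ 2 ∂P - (∫ ω, Y j ω ∂P) ^ 2) := by
    intro j
    simp only [mul_pow]
    rw [integral_const_mul, hr2, ← variance_eq_integral (hm j), variance_eq_sub (hlpY j)]
    rfl
  simp only [e2] at h1
  refine h1.trans ?_
  have h3 : ∀ j, ∫ ω, |r * (Y j ω - ∫ ω', Y j ω' ∂P)| ^ 3 ∂P ≤ (r * (2 * A)) ^ 3 := by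
    intro j
    have := norm_integral_le_of_norm_le_const (μ := P)
      (f := fun ω => |r * (Y j ω - ∫ ω', Y j ω' ∂P)| ^ 3) (C := (r * (2 * A)) ^ 3)
      (ae_of_all _ fun ω => by
        rw [Real.norm_eq_abs, abs_of_nonneg (by positivity)]
        exact pow_le_pow_left₀ (abs_nonneg _) (hbd j ω) 3)
    simpa using (le_abs_self _).trans this
  have h4 : ∀ j, ∫ ω, (r * (Y j ω - ∫ ω', Y j ω' ∂P)) ^ 4 ∂P ≤ (r * (2 * A)) ^ 4 := by
    intro j
    have := norm_integral_le_of_norm_le_const (μ := P)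
      (f := fun ω => (r * (Y j ω - ∫ ω', Y j ω' ∂P)) ^ 4) (C := (r * (2 * A)) ^ 4)
      (ae_of_all _ fun ω => by
        rw [norm_pow]
        exact pow_le_pow_left₀ (norm_nonneg _) (hbd j ω) 4)
    simpa using (le_abs_self _).trans this
  refine (Finset.sum_le_sum fun j _ => add_le_add (mul_le_mul_of_nonneg_left (h3 j)
    (by norm_num : (0 : ℝ) ≤ 4)) (h4 j)).trans (le_of_eq ?_)
  simp only [Finset.sum_const, Finset.card_univ, Fintype.card_fin, nsmul_eq_mul]
  -- Summing `n` terms of sizes `r ^ 3` and `r ^ 4` leaves `r` and `r ^ 2`.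
  have hn2 : (n : ℝ) * r ^ 2 = 1 := by rw [hr2, mul_inv_cancel₀ hn'.ne']
  rw [← hr2]
  linear_combination (4 * (2 * A) ^ 3 * r + (2 * A) ^ 4 * r ^ 2) * hn2

end Assembly

/-! ### Cramér–Wold and the limit of the characteristic functions -/

section Main

variable {Ω : Type*} [MeasurableSpace Ω] {P : Measure Ω} [IsProbabilityMeasure P]
  {Ω' : Type*} [MeasurableSpace Ω'] {P' : Measure Ω'} [IsProbabilityMeasure P']

theorem LagAssumption.exists_isLag {Ψ : (n : ℕ) → ℕ → Matrix (Fin n) (Fin n) ℝ}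
    (h : LagAssumption Ψ) :
    ∃ b B : ℝ, 0 < b ∧ ∀ n (j : Fin n), IsLag b B fun i => Ψ n i j j := by
  obtain ⟨b, B, hb, -, h⟩ := h.bounds
  exact ⟨b, B, hb, fun n j => ⟨(h n j).1, (h n j).2.1, (h n j).2.2⟩⟩

theorem IsLag.tsum_ne_zero {b B : ℝ} {ψ : ℕ → ℝ} (h : IsLag b B ψ) (hb : 0 < b) :
    ∑' i, ψ i ≠ 0 := by
  intro h0
  have := h.le_abs_tsum
  rw [h0, abs_zero] at this
  linarith

theorem ae_M_eq {ε : ℕ → ℤ → Ω → ℝ} {κ b B : ℝ} (hε : ∀ i, IsWhiteNoise P κ (ε i)) {n : ℕ}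
    {Ψ : ℕ → Matrix (Fin n) (Fin n) ℝ} (hd : ∀ k, (Ψ k).IsDiag)
    (hΨ : ∀ j, IsLag b B fun i => Ψ i j j) (hb : 0 < b) (T : ℕ) :
    ∀ᵐ ω ∂P, ∀ (j : Fin n) (k l : ℕ), M ε Ψ T j (k + 1) (l + 1) ω
      = rowCoord (fun i => Ψ i j j) T k (fun t => ε j t ω)
        * rowCoord (fun i => Ψ i j j) T l (fun t => ε j t ω)
        / ∑ k ∈ Finset.range (T - 1), rowCoord (fun i => Ψ i j j) T k (fun t => ε j t ω) ^ 2 := by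
  have h1 : ∀ᵐ ω ∂P, ∀ (j : Fin n) (t : ℤ), Summable fun i : ℕ => Ψ i j j * ε j (t - i) ω :=
    ae_all_iff.2 fun j => (hε j).ae_summable (hΨ j).summable_abs
  filter_upwards [h1] with ω hω j k l
  exact M_eq_rowCoord T j ((hΨ j).tsum_ne_zero hb)
    (fun t => linearProcess_eq_filterPath hd hω t j) k l

theorem aemeasurable_M {ε : ℕ → ℤ → Ω → ℝ} {κ b B : ℝ} (hε : ∀ i, IsWhiteNoise P κ (ε i)) {n : ℕ}
    {Ψ : ℕ → Matrix (Fin n) (Fin n) ℝ} (hd : ∀ k, (Ψ k).IsDiag)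
    (hΨ : ∀ j, IsLag b B fun i => Ψ i j j) (hb : 0 < b) (T : ℕ) (j : Fin n) (k l : ℕ) :
    AEMeasurable (M ε Ψ T j (k + 1) (l + 1)) P := by
  have hc : ∀ k, AEMeasurable (fun ω => rowCoord (fun i => Ψ i j j) T k fun t => ε j t ω) P :=
    fun k => (hε j).aemeasurable_rowCoord _ T k
  refine (((hc k).mul (hc l)).div (Finset.aemeasurable_fun_sum (Finset.range (T - 1))
    fun k _ => (hc k).pow_const 2)).congr ?_
  filter_upwards [ae_M_eq hε hd hΨ hb T] with ω hω
  exact (hω j k l).symm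

theorem integrable_M {ε : ℕ → ℤ → Ω → ℝ} {κ b B : ℝ} (hε : ∀ i, IsWhiteNoise P κ (ε i)) {n : ℕ}
    {Ψ : ℕ → Matrix (Fin n) (Fin n) ℝ} (hd : ∀ k, (Ψ k).IsDiag)
    (hΨ : ∀ j, IsLag b B fun i => Ψ i j j) (hb : 0 < b) {T K : ℕ} (hT : K < T) (j : Fin n)
    {k l : ℕ} (hk : k < K) (hl : l < K) :
    Integrable (M ε Ψ T j (k + 1) (l + 1)) P := by
  refine Integrable.of_bound (aemeasurable_M hε hd hΨ hb T j k l).aestronglyMeasurable 1 ?_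
  filter_upwards [ae_M_eq hε hd hΨ hb T] with ω hω
  rw [hω j k l]
  exact abs_mul_div_le_one (b := fun k => rowCoord (fun i => Ψ i j j) T k fun t => ε j t ω)
    (m := T - 1) (by omega) (by omega) le_rfl

/-- Cramér–Wold reduction to scalar row variables. `M` is replaced by its almost sure version
`rowQuad`, a measurable function of one noise path, through which independence of the rows applies.
-/
theorem charFun_normalizedArray {ε : ℕ → ℤ → Ω → ℝ} {κ b B : ℝ}
    (hε : ∀ i, IsWhiteNoise P κ (ε i)) {n : ℕ} {Ψ : ℕ → Matrix (Fin n) (Fin n) ℝ}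
    (hd : ∀ k, (Ψ k).IsDiag) (hΨ : ∀ j, IsLag b B fun i => Ψ i j j) (hb : 0 < b) {T K : ℕ}
    (hT : K < T) (s : EuclideanSpace ℝ (Fin K × Fin K)) :
    charFun (P.map (normalizedArray P ε Ψ T K)) s
      = ∫ ω, Complex.exp ((∑ j : Fin n, (Real.sqrt n)⁻¹
          * (rowQuad s (fun i => Ψ i j j) T (fun t => ε j t ω)
            - ∫ ω', rowQuad s (fun i => Ψ i j j) T (fun t => ε j t ω') ∂P) : ℝ)
          * Complex.I) ∂P := by
  have hq : ∀ᵐ ω ∂P, ∀ j : Fin n, ∑ p, s p * M ε Ψ T j ((p.1 : ℕ) + 1) ((p.2 : ℕ) + 1) ω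
      = rowQuad s (fun i => Ψ i j j) T fun t => ε j t ω := by
    filter_upwards [ae_M_eq hε hd hΨ hb T] with ω hω j
    simp only [hω, rowQuad, quadRatio]
  have hE : ∀ j : Fin n,
      ∑ p, s p * ∫ ω', M ε Ψ T j ((p.1 : ℕ) + 1) ((p.2 : ℕ) + 1) ω' ∂P
      = ∫ ω', rowQuad s (fun i => Ψ i j j) T (fun t => ε j t ω') ∂P := by
    intro j
    rw [← integral_congr_ae (hq.mono fun ω hω => hω j), integral_finsetSum _ fun p _ =>
      (integrable_M hε hd hΨ hb hT j p.1.2 p.2.2).const_mul _]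
    simp only [integral_const_mul]
  have hm : ∀ p : Fin K × Fin K, AEMeasurable (fun ω => (Real.sqrt n)⁻¹ * ∑ j : Fin n,
      (M ε Ψ T j ((p.1 : ℕ) + 1) ((p.2 : ℕ) + 1) ω
        - ∫ ω', M ε Ψ T j ((p.1 : ℕ) + 1) ((p.2 : ℕ) + 1) ω' ∂P)) P :=
    fun p => (Finset.aemeasurable_fun_sum _ fun j _ =>
      (aemeasurable_M hε hd hΨ hb T j p.1 p.2).sub_const _).const_mul _
  refine (charFun_map_toLp hm s).trans (integral_congr_ae ?_)
  filter_upwards [hq] with ω hω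
  have e : ∑ p, s p * ((Real.sqrt n)⁻¹ * ∑ j : Fin n,
      (M ε Ψ T j ((p.1 : ℕ) + 1) ((p.2 : ℕ) + 1) ω
        - ∫ ω', M ε Ψ T j ((p.1 : ℕ) + 1) ((p.2 : ℕ) + 1) ω' ∂P))
      = ∑ j : Fin n, (Real.sqrt n)⁻¹ * (rowQuad s (fun i => Ψ i j j) T (fun t => ε j t ω)
            - ∫ ω', rowQuad s (fun i => Ψ i j j) T (fun t => ε j t ω') ∂P) := by
    simp only [← hω, ← hE, ← Finset.sum_sub_distrib, Finset.mul_sum]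
    rw [Finset.sum_comm]
    exact Finset.sum_congr rfl fun j _ => Finset.sum_congr rfl fun p _ => by ring
  rw [e]

theorem tendsto_charFun_normalizedArray {ε : ℕ → ℤ → Ω → ℝ} (hε : NoiseAssumption P ε)
    {Ψ : (n : ℕ) → ℕ → Matrix (Fin n) (Fin n) ℝ} (hΨ : LagAssumption Ψ) {T : ℕ → ℕ}
    (hT : Tendsto T atTop atTop) {Z : ℕ+ → Ω' → ℝ} (hZi : iIndepFun Z P')
    (hZ : ∀ t, HasLaw (Z t) (gaussianReal 0 1) P') {K : ℕ}
    (s : EuclideanSpace ℝ (Fin K × Fin K)) :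
    Tendsto (fun n => charFun (P.map (normalizedArray P ε (Ψ n) (T n) K)) s) atTop
      (𝓝 (Complex.exp (-((s ⬝ᵥ limitCov P' Z K *ᵥ s : ℝ) / 2 : ℂ)))) := by
  obtain ⟨κ, hη⟩ := hε.exists_isWhiteNoise
  obtain ⟨b, B, hb, hψ⟩ := hΨ.exists_isLag
  set A : ℝ := ∑ p, |s p| with hA
  have hA0 : 0 ≤ A := Finset.sum_nonneg fun _ _ => abs_nonneg _
  have hTl : Tendsto (fun i : Σ n : ℕ, Fin n => T i.1) (comap Sigma.fst atTop) atTop :=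
    hT.comp tendsto_comap
  have hZi' : iIndepFun (fun k : ℕ => Z k.succPNat) P' := hZi.precomp Nat.succPNat_injective
  have hG1 := tendsto_integral_rowCoord (l := comap Sigma.fst atTop)
    (η := fun i : Σ n : ℕ, Fin n => ε i.2) (ψ := fun i k => Ψ i.1 k i.2 i.2)
    (fun i => hη i.2) (fun i => hψ i.1 i.2) hb hTl hZi' (fun k => hZ k.succPNat) s
    (L := 1) (G := fun x => x) zero_le_one continuous_id (fun x y _ _ => by simp)
  -- `hG1` gives the row means and `hG2` the second moments; squaring is `2 * A`-Lipschitz on `[-A,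
  -- A]`. Together they give the row variances, uniformly in the row.
  have hG2 := tendsto_integral_rowCoord (l := comap Sigma.fst atTop)
    (η := fun i : Σ n : ℕ, Fin n => ε i.2) (ψ := fun i k => Ψ i.1 k i.2 i.2)
    (fun i => hη i.2) (fun i => hψ i.1 i.2) hb hTl hZi' (fun k => hZ k.succPNat) s
    (L := 2 * A) (G := fun x => x ^ 2) (by positivity) (continuous_pow 2) (fun x y hx hy => by
      rw [sq_sub_sq, abs_mul]
      refine mul_le_mul_of_nonneg_right ((abs_add_le _ _).trans ?_) (abs_nonneg _)
      linarith)
  have hlim : ∀ ω, quadRatio s (fun k => 1 / (k + 1 : ℕ) * Z k.succPNat ω)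
      (∑' k : ℕ, (1 / (k + 1 : ℕ) * Z k.succPNat ω) ^ 2)
      = ∑ p, s p * limitM Z (p.1 : ℕ).succPNat (p.2 : ℕ).succPNat ω := by
    intro ω
    simp only [quadRatio, limitM_eq]
  have hlp : MemLp (fun ω => ∑ p, s p * limitM Z (p.1 : ℕ).succPNat (p.2 : ℕ).succPNat ω) 2 P' :=
    memLp_finsetSum _ fun p _ => (memLp_limitM (fun t => (hZ t).aemeasurable) _ _).const_mul _
  have hV := hG2.sub (hG1.pow 2)
  simp only [hlim] at hV
  have hV' : (∫ ω, (∑ p, s p * limitM Z (p.1 : ℕ).succPNat (p.2 : ℕ).succPNat ω) ^ 2 ∂P')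
      - (∫ ω, ∑ p, s p * limitM Z (p.1 : ℕ).succPNat (p.2 : ℕ).succPNat ω ∂P') ^ 2
      = s ⬝ᵥ limitCov P' Z K *ᵥ s := by
    rw [dotProduct_limitCov_mulVec fun t => (hZ t).aemeasurable, variance_eq_sub hlp]
    rfl
  rw [hV'] at hV
  have havg := tendsto_average hV
  have hexp := (Complex.continuous_exp.tendsto _).comp
    (((Complex.continuous_ofReal.tendsto _).comp havg).div_const 2).neg
  have hinv : Tendsto (fun n : ℕ => (n : ℝ)⁻¹) atTop (𝓝 0) := tendsto_inv_atTop_nhds_zero_nat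
  have hsq : Tendsto (fun n : ℕ => (Real.sqrt n)⁻¹) atTop (𝓝 0) := by
    have := (Real.continuous_sqrt.tendsto 0).comp hinv
    rw [Real.sqrt_zero] at this
    exact this.congr fun n => by simp [Real.sqrt_inv]
  have herr := (hsq.const_mul (4 * (2 * A) ^ 3)).add (hinv.const_mul ((2 * A) ^ 4))
  simp only [mul_zero, add_zero] at herr
  have hrows := iIndepFun_rows hε.measurable hε.indep
  have hd := squeeze_zero_norm' (f := fun n =>
      charFun (P.map (normalizedArray P ε (Ψ n) (T n) K)) s
      - Complex.exp (-((∑ j : Fin n, (n : ℝ)⁻¹ *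
        (∫ ω, rowQuad s (fun i => Ψ n i j j) (T n) (fun t => ε j t ω) ^ 2 ∂P
        - (∫ ω, rowQuad s (fun i => Ψ n i j j) (T n) (fun t => ε j t ω) ∂P) ^ 2) : ℝ) / 2 : ℂ)))
    (by
      filter_upwards [eventually_gt_atTop 0, hT.eventually_gt_atTop K] with n hn hTn
      rw [charFun_normalizedArray hη (hΨ.diagonal n) (hψ n) hb hTn s]
      refine norm_integral_exp_normalized_sum_sub_le hn
        (Y := fun j ω => rowQuad s (fun i => Ψ n i j j) (T n) fun t => ε j t ω) ?_ (fun j => ?_)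
        fun j ω => abs_rowQuad_le s _ hTn _
      · exact (hrows.precomp Fin.val_injective).comp
          (fun j : Fin n => rowQuad s (fun i => Ψ n i j j) (T n))
          fun j => measurable_rowQuad s _ _
      · exact ((measurable_rowQuad s _ _).comp
          (measurable_pi_iff.2 fun t => hε.measurable j t)).aemeasurable) herr
  have := hd.add hexp
  rw [zero_add] at this
  refine this.congr fun n => ?_
  simp only [Function.comp_apply, rowQuad]
  exact sub_add_cancel _ _

end Main

end UnitRootCLT

theorem mainTheorem6
    {Ω : Type*} [MeasurableSpace Ω] (P : Measure Ω) [IsProbabilityMeasure P]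
    (ε : ℕ → ℤ → Ω → ℝ) (hε : UnitRootCLT.NoiseAssumption P ε)
    (Ψ : (n : ℕ) → ℕ → Matrix (Fin n) (Fin n) ℝ) (hΨ : UnitRootCLT.LagAssumption Ψ)
    (T : ℕ → ℕ) (hT : Tendsto T atTop atTop)
    (c : ℝ) (hc : 0 < c) (hTc : Tendsto (fun n : ℕ => (n : ℝ) / (T n : ℝ)) atTop (𝓝 c))
    {Ω' : Type*} [MeasurableSpace Ω'] (P' : Measure Ω') [IsProbabilityMeasure P']
    (Z : ℕ+ → Ω' → ℝ) (hZ_indep : iIndepFun Z P')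
    (hZ_law : ∀ t, HasLaw (Z t) (gaussianReal 0 1) P')
    (K : ℕ) (hK : 0 < K) :
    (UnitRootCLT.limitCov P' Z K).PosSemidef ∧
    TendstoInDistribution
      (fun (n : ℕ) (ω : Ω) => UnitRootCLT.normalizedArray P ε (Ψ n) (T n) K ω)
      atTop
      (fun x : EuclideanSpace ℝ (Fin K × Fin K) => x)
      (fun _ => P)
      (multivariateGaussian 0 (UnitRootCLT.limitCov P' Z K)) := by
  -- Positive semidefiniteness, not invertibility, is what the characteristic function of
  -- `multivariateGaussian` requires, so degenerate limits are covered.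
  have hpsd := UnitRootCLT.posSemidef_limitCov (P' := P') (fun t => (hZ_law t).aemeasurable) K
  refine ⟨hpsd, fun n => ?_, aemeasurable_id, ?_⟩
  · obtain ⟨κ, hη⟩ := hε.exists_isWhiteNoise
    obtain ⟨b, B, hb, hψ⟩ := hΨ.exists_isLag
    exact (WithLp.measurable_toLp 2 _).comp_aemeasurable (aemeasurable_pi_lambda _ fun p =>
      (Finset.aemeasurable_fun_sum _ fun j _ =>
        (UnitRootCLT.aemeasurable_M hη (hΨ.diagonal n) (hψ n) hb (T n) j p.1 p.2).sub_const
          _).const_mul _)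
  · refine ProbabilityMeasure.tendsto_iff_tendsto_charFun.2 fun s => ?_
    have h := UnitRootCLT.tendsto_charFun_normalizedArray hε hΨ hT hZ_indep hZ_law s
    have e : charFun ((multivariateGaussian 0 (UnitRootCLT.limitCov P' Z K)).map
        fun x : EuclideanSpace ℝ (Fin K × Fin K) => x) s
        = Complex.exp (-((s ⬝ᵥ UnitRootCLT.limitCov P' Z K *ᵥ s : ℝ) / 2 : ℂ)) := by
      rw [Measure.map_id', charFun_multivariateGaussian hpsd]
      simp
    rw [← e] at h
    exact h
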